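/- Let $\kappa$ be a strongly inaccessible uncountable cardinal. Call a set small if its cardinality is $<\kappa$ and a class if its cardinality is $\le\kappa$, and let $\mathsf{Class}$ be the category of classes and functions. Let $H:\mathsf{Class}\to\mathsf{Class}$ be any functor. Definitions. An ideal monad is a monad $(S,\eta,\mu)$ on $\mathsf{Class}$ with a functor $S'$ and a natural transformation $\sigma:S'\to S$ such that $[\sigma,\eta]:S'+\mathrm{Id}\to S$ is an isomorphism and $\mu$ restricts to a natural transformation $S'S\to S'$. A morphism $e:X\to S(X+Y)$ is guarded if it factorizes through $[\sigma_{X+Y},\eta_{X+Y}\cdot\mathrm{inr}]:S'(X+Y)+Y\to S(X+Y)$. The ideal monad is completely iterative if every guarded $e:X\to S(X+Y)$ (for all classes $X,Y$) has a unique solution, i.e. there is a unique $e^\dagger:X\to SY$ with $e^\dagger=\mu_Y\cdot S[e^\dagger,\eta_Y]\cdot e$. A natural transformation $H\to S$ is ideal if it factorizes through $\sigma$; a monad morphism between ideal monads is ideal if it restricts to the ideals. A free completely iterative monad on $H$ is a completely iterative monad $T$ with an ideal transformation $\iota:H\to T$ such that for every completely iterative monad $S$ and every ideal transformation $\lambda:H\to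 S$ there is a unique ideal monad morphism $h:T\to S$ with $h\cdot\iota=\lambda$. A signature $\Sigma$ is a class of operation symbols $s$ with small arities $\mathrm{ar}(s)$; $H_\Sigma X=\coprod_{s\in\Sigma}X^{\mathrm{ar}(s)}$; the tree monad $T_\Sigma$ assigns to $Y$ the class of all (not necessarily well-founded) trees in which every node is either labelled by an operation symbol $s$ and has exactly $\mathrm{ar}(s)$ children, or is a leaf labelled by an element of $Y$; its unit is the singleton-tree embedding and its multiplication is substitution of trees for leaves. Let $\iota_\Sigma:H_\Sigma\to T_\Sigma$ be the inclusion of flat trees. Then: 1. For every class $X$ the functor $H(-)+X$ has a terminal coalgebra $TX$. 2. $H$ generates a free completely iterative monad: there are a monad $(T,\eta,\mu)$ and a natural transformation $\tau:HT\to T$ such that for every $X$ the morphism $[\tau_X,\eta_X]:HTX+X\to TX$ is an isomorphism whose inverse makes $TX$ a terminal coalgebra of $H(-)+X$, such that $\mu\cdot\tau T=\tau\cdot H\mu$, and such that $T$ with the ideal $\tau:HT\to T$ and the transformation $\tau\cdot H\eta:H\to T$ is a free completely iterative monad on $H$. 3. The free completely iterative monad on $H$ is a quotient of a tree monad: there are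 a signature $\Sigma$ and a natural transformation $\varepsilon:H_\Sigma\to H$ with epimorphic components; and for every free completely iterative monad $(T,\iota)$ on $H$, every signature $\Sigma$ and every $\varepsilon:H_\Sigma\to H$ with epimorphic components there is a monad morphism $q:T_\Sigma\to T$ with epimorphic components such that $q\cdot\iota_\Sigma=\iota\cdot\varepsilon$. -/

import Mathlib

open CategoryTheory CategoryTheory.Limits

universe u

/-! ## The category of classes

A strongly inaccessible uncountable cardinal `κ` is fixed.  Small sets are the sets of cardinality
`< κ`, classes are the sets of cardinality `≤ κ`. -/

/-- A class: a type of cardinality at most `κ`. -/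
structure ClassCat (κ : Cardinal.{u}) : Type (u + 1) where
  carrier : Type u
  card_le : Cardinal.mk carrier ≤ κ

namespace ClassCat

variable {κ : Cardinal.{u}}

instance : CoeSort (ClassCat κ) (Type u) := ⟨ClassCat.carrier⟩

/-- The category of classes and all functions between them. -/
instance : Category.{u} (ClassCat κ) where
  Hom X Y := X.carrier → Y.carrier
  id X := fun x => x
  comp f g := fun x => g (f x)

theorem comp_apply {X Y Z : ClassCat κ} (f : X ⟶ Y) (g : Y ⟶ Z) (x : X) :
    (f ≫ g) x = g (f x) := rfl

theorem id_apply {X : ClassCat κ} (x : X) : (𝟙 X : X ⟶ X) x = x := rfl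

variable [hκ : Fact κ.IsInaccessible]

theorem aleph0_le : Cardinal.aleph0 ≤ κ := hκ.out.isRegular.aleph0_le

/-- `κ ^ α ≤ κ` for every small cardinal `α`, stated for function types. -/
theorem mk_fun_le {A X : Type u} (hA : Cardinal.mk A < κ) (hX : Cardinal.mk X ≤ κ) :
    Cardinal.mk (A → X) ≤ κ := by
  rcases isEmpty_or_nonempty A with hE | hN
  · have : Cardinal.mk (A → X) ≤ 1 := Cardinal.le_one_iff_subsingleton.2 inferInstance
    exact this.trans (Cardinal.one_le_aleph0.trans aleph0_le)
  have h1 : Cardinal.mk (A → X) ≤ Cardinal.mk (A → κ.out) := by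
    have : Cardinal.mk X ≤ Cardinal.mk κ.out := by simpa using hX
    obtain ⟨e⟩ := this
    exact ⟨⟨fun f a => e (f a), fun f g h => funext fun a => e.injective (congrFun h a)⟩⟩
  have h2 : Cardinal.mk (A × κ.out) = κ := by
    rw [Cardinal.mk_prod]
    simp only [Cardinal.lift_id, Cardinal.mk_out]
    exact Cardinal.mul_eq_right aleph0_le hA.le (Cardinal.mk_ne_zero A)
  have h3 : Cardinal.mk {s : Set (A × κ.out) //
      Cardinal.mk s < (Cardinal.mk (A × κ.out)).ord.cof} = κ := by
    rw [Cardinal.mk_subset_mk_lt_cof, h2]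
    intro x hx
    rw [h2] at hx ⊢
    exact hκ.out.isStrongLimit.isStrongPrelimit hx
  refine h1.trans (le_trans ?_ h3.le)
  have hc : (Cardinal.mk (A × κ.out)).ord.cof = κ := by
    rw [h2, hκ.out.isRegular.cof_ord]
  refine ⟨⟨fun f => ⟨Set.range fun a => (a, f a), ?_⟩, fun f g h => ?_⟩⟩
  · rw [hc]
    exact Cardinal.mk_range_le.trans_lt hA
  · funext a
    have h' : Set.range (fun a => (a, f a)) = Set.range (fun a => (a, g a)) :=
      congrArg Subtype.val h
    have : (a, f a) ∈ Set.range (fun a => (a, g a)) := h' ▸ ⟨a, rfl⟩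
    obtain ⟨b, hb⟩ := this
    simp only [Prod.mk.injEq] at hb
    obtain ⟨rfl, hb⟩ := hb
    exact hb.symm

theorem mk_sigma_le {A : Type u} {B : A → Type u} (hA : Cardinal.mk A ≤ κ)
    (hB : ∀ a, Cardinal.mk (B a) ≤ κ) : Cardinal.mk (Σ a, B a) ≤ κ := by
  rw [Cardinal.mk_sigma]
  refine (Cardinal.sum_le_sum _ (fun _ => κ) hB).trans ?_
  rw [Cardinal.sum_const']
  exact (mul_le_mul' hA le_rfl).trans (Cardinal.mul_eq_self aleph0_le).le

theorem mk_sum_le {A B : Type u} (hA : Cardinal.mk A ≤ κ) (hB : Cardinal.mk B ≤ κ) :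
    Cardinal.mk (A ⊕ B) ≤ κ := by
  rw [Cardinal.mk_sum]
  simpa using Cardinal.add_le_of_le aleph0_le hA hB

/-- The coproduct `X + Y` of two classes. -/
def sum (X Y : ClassCat κ) : ClassCat κ := ⟨X.carrier ⊕ Y.carrier, mk_sum_le X.card_le Y.card_le⟩

def inl (X Y : ClassCat κ) : X ⟶ sum X Y := fun x => Sum.inl x

def inr (X Y : ClassCat κ) : Y ⟶ sum X Y := fun y => Sum.inr y

/-- The copairing `[f, g] : X + Y ⟶ Z`. -/
def desc {X Y Z : ClassCat κ} (f : X ⟶ Z) (g : Y ⟶ Z) : sum X Y ⟶ Z := fun s => Sum.elim f g s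

/-- `f + g`. -/
def sumMap {X Y X' Y' : ClassCat κ} (f : X ⟶ X') (g : Y ⟶ Y') : sum X Y ⟶ sum X' Y' :=
  desc (f ≫ inl X' Y') (g ≫ inr X' Y')

/-- `sum X Y` really is a coproduct in the category of classes. -/
theorem sum_isColimit (X Y : ClassCat κ) :
    Nonempty (IsColimit (BinaryCofan.mk (inl X Y) (inr X Y))) :=
  ⟨BinaryCofan.isColimitMk (fun s => desc s.inl s.inr) (fun _ => rfl) (fun _ => rfl)
    (fun s m h1 h2 => by
      funext x
      rcases x with x | y
      · exact congrFun h1 x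
      · exact congrFun h2 y)⟩

/-- The endofunctor `H(-) + X`. -/
def plus (H : ClassCat κ ⥤ ClassCat κ) (X : ClassCat κ) : ClassCat κ ⥤ ClassCat κ where
  obj Z := sum (H.obj Z) X
  map f := sumMap (H.map f) (𝟙 X)
  map_id Z := by
    funext x
    rcases x with x | x
    · change Sum.inl (H.map (𝟙 Z) x) = Sum.inl x
      rw [H.map_id]; rfl
    · rfl
  map_comp f g := by
    funext x
    rcases x with x | x
    · change Sum.inl (H.map (f ≫ g) x) = Sum.inl (H.map g (H.map f x))
      rw [H.map_comp]; rfl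
    · rfl

end ClassCat

open ClassCat

section Monads

variable {κ : Cardinal.{u}} [Fact κ.IsInaccessible]

/-! ## Completely iterative monads -/

/-- An ideal monad on the category of classes: a monad `(S, η, μ)` with an ideal `σ : S' ⟶ S` such
that `S = S' + Id` with coproduct injections `σ` and `η`, and such that `μ` restricts to a natural
transformation `S'S ⟶ S'`. -/
structure IdealMonad (κ : Cardinal.{u}) [Fact κ.IsInaccessible] where
  monad : Monad (ClassCat κ)
  ideal : ClassCat κ ⥤ ClassCat κ
  incl : ideal ⟶ monad.toFunctor
  mult : monad.toFunctor ⋙ ideal ⟶ ideal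
  isIso_desc : ∀ X, IsIso (desc (incl.app X) (monad.η.app X))
  mult_incl : ∀ X, mult.app X ≫ incl.app X = incl.app (monad.obj X) ≫ monad.μ.app X

namespace IdealMonad

/-- The equation morphism `e : X ⟶ S(X + Y)` is guarded: it factorizes through
`S'(X + Y) + Y ⟶ S(X + Y)`. -/
def Guarded (S : IdealMonad κ) {X Y : ClassCat κ} (e : X ⟶ S.monad.obj (sum X Y)) : Prop :=
  ∃ g : X ⟶ sum (S.ideal.obj (sum X Y)) Y,
    e = g ≫ desc (S.incl.app (sum X Y)) (inr X Y ≫ S.monad.η.app (sum X Y))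

/-- `s : X ⟶ S Y` solves `e : X ⟶ S(X + Y)`: `s = μ ∘ S[s, η] ∘ e`. -/
def IsSolution (S : IdealMonad κ) {X Y : ClassCat κ} (e : X ⟶ S.monad.obj (sum X Y))
    (s : X ⟶ S.monad.obj Y) : Prop :=
  s = e ≫ S.monad.map (desc s (S.monad.η.app Y)) ≫ S.monad.μ.app Y

/-- Every guarded equation morphism has a unique solution. -/
def CompletelyIterative (S : IdealMonad κ) : Prop :=
  ∀ (X Y : ClassCat κ) (e : X ⟶ S.monad.obj (sum X Y)), S.Guarded e → ∃! s, S.IsSolution e s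

/-- A natural transformation into an ideal monad is ideal if it factorizes through the ideal. -/
def IsIdealTransformation {H : ClassCat κ ⥤ ClassCat κ} (S : IdealMonad κ)
    (l : H ⟶ S.monad.toFunctor) : Prop :=
  ∃ l' : H ⟶ S.ideal, l = l' ≫ S.incl

/-- A monad morphism between ideal monads is ideal if it restricts to the ideals. -/
def IsIdealMorphism (S R : IdealMonad κ) (h : MonadHom S.monad R.monad) : Prop :=
  ∃ h' : S.ideal ⟶ R.ideal, S.incl ≫ h.toNatTrans = h' ≫ R.incl

/-- `T` with the universal arrow `i : H ⟶ T` is a free completely iterative monad on `H`. -/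
def IsFreeOn (H : ClassCat κ ⥤ ClassCat κ) (T : IdealMonad κ) (i : H ⟶ T.monad.toFunctor) : Prop :=
  T.CompletelyIterative ∧ T.IsIdealTransformation i ∧
    ∀ (S : IdealMonad κ) (l : H ⟶ S.monad.toFunctor), S.CompletelyIterative →
      S.IsIdealTransformation l →
        ∃! h : MonadHom T.monad S.monad, IsIdealMorphism T S h ∧ i ≫ h.toNatTrans = l

end IdealMonad

/-- A monad `(T, η, μ)` generated by `H`: each `TX` is an `H`-algebra via `τ`, it is the coproduct
of `HTX` and `X` with injections `τ` and `η`, the multiplication `μ` is an `H`-algebra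
homomorphism, and the inverse of `[τ, η] : HTX + X ⟶ TX` makes `TX` a terminal coalgebra of
`H(-) + X`. -/
structure GeneratedMonad (H : ClassCat κ ⥤ ClassCat κ) where
  monad : Monad (ClassCat κ)
  τ : monad.toFunctor ⋙ H ⟶ monad.toFunctor
  isIso_desc : ∀ X, IsIso (desc (τ.app X) (monad.η.app X))
  τ_mult : ∀ X, H.map (monad.μ.app X) ≫ τ.app X = τ.app (monad.obj X) ≫ monad.μ.app X
  terminal : ∀ X, Nonempty (IsTerminal
    ({ V := monad.obj X
       str := @inv _ _ _ _ (desc (τ.app X) (monad.η.app X)) (isIso_desc X) } :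
      Endofunctor.Coalgebra (plus H X)))

namespace GeneratedMonad

variable {H : ClassCat κ ⥤ ClassCat κ}

/-- The generated monad as an ideal monad, with ideal `τ : HT ⟶ T`. -/
def toIdealMonad (T : GeneratedMonad H) : IdealMonad κ where
  monad := T.monad
  ideal := T.monad.toFunctor ⋙ H
  incl := T.τ
  mult := Functor.whiskerRight T.monad.μ H
  isIso_desc := T.isIso_desc
  mult_incl := T.τ_mult

/-- The arrow `τ ∘ Hη : H ⟶ HT ⟶ T`. -/
def unit (T : GeneratedMonad H) : H ⟶ T.monad.toFunctor where
  app X := H.map (T.monad.η.app X) ≫ T.τ.app X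
  naturality X Y f := by
    have h1 := T.monad.η.naturality f
    have h2 := T.τ.naturality f
    simp only [Functor.id_map, Functor.comp_map] at h1 h2
    rw [← Category.assoc, ← H.map_comp]
    erw [h1]
    rw [H.map_comp, Category.assoc]
    erw [h2]
    rw [Category.assoc]

end GeneratedMonad

end Monads

/-! ## Signatures, polynomial functors and tree monads -/

/-- A (possibly large) signature: a class of operation symbols with small arities. -/
structure Signature (κ : Cardinal.{u}) where
  Op : ClassCat κ
  ar : Op.carrier → Cardinal.{u}
  ar_lt : ∀ s, ar s < κ

namespace Signature

variable {κ : Cardinal.{u}}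

/-- The argument positions `{i | i < ar s}` of the symbol `s`. -/
abbrev Pos (Sg : Signature κ) (s : Sg.Op.carrier) : Type u := (Sg.ar s).ord.ToType

theorem mk_pos_lt (Sg : Signature κ) (s : Sg.Op.carrier) : Cardinal.mk (Sg.Pos s) < κ := by
  simpa using Sg.ar_lt s

/-- The shapes of nodes of `Σ`-trees over `Y`: a node is labelled either by an operation symbol `s`
and then has `ar s` children, or by an element of `Y` and then is a leaf. -/
def shape (Sg : Signature κ) (Y : ClassCat κ) : PFunctor.{u, u} where
  A := Sg.Op.carrier ⊕ Y.carrier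
  B := Sum.elim Sg.Pos fun _ => PEmpty

/-- The `Σ`-trees over `Y`, not necessarily well-founded. -/
abbrev Tree (Sg : Signature κ) (Y : ClassCat κ) : Type u := (Sg.shape Y).M

namespace Tree

variable {Sg : Signature κ} {X Y Z : ClassCat κ}

/-- The singleton tree labelled by `y`. -/
def leaf (Sg : Signature κ) {Y : ClassCat κ} (y : Y.carrier) : Tree Sg Y :=
  PFunctor.M.mk ⟨Sum.inr y, fun i => PEmpty.elim i⟩

/-- Tree tupling: the tree with root `s` and the given children. -/
def node (s : Sg.Op.carrier) (f : Sg.Pos s → Tree Sg Y) : Tree Sg Y :=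
  PFunctor.M.mk ⟨Sum.inl s, f⟩

theorem dest_leaf (y : Y.carrier) :
    PFunctor.M.dest (leaf Sg y) = ⟨Sum.inr y, fun i => PEmpty.elim i⟩ := rfl

theorem dest_node (s : Sg.Op.carrier) (f : Sg.Pos s → Tree Sg Y) :
    PFunctor.M.dest (node s f) = ⟨Sum.inl s, f⟩ := rfl

theorem leaf_or_node (t : Tree Sg Y) : (∃ y, t = leaf Sg y) ∨ ∃ s f, t = node s f := by
  rcases h : PFunctor.M.dest t with ⟨a | y, f⟩
  · exact Or.inr ⟨a, f, by rw [← PFunctor.M.mk_dest t, h]; rfl⟩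
  · refine Or.inl ⟨y, ?_⟩
    rw [← PFunctor.M.mk_dest t, h]
    have : f = fun i => PEmpty.elim i := funext fun i => PEmpty.elim i
    rw [this]; rfl

/-- One step of substitution. -/
def substStep (g : Y.carrier → Tree Sg Z) :
    Tree Sg Y ⊕ Tree Sg Z → (Sg.shape Z) (Tree Sg Y ⊕ Tree Sg Z)
  | Sum.inl t =>
    match PFunctor.M.dest t with
    | ⟨Sum.inl s, f⟩ => ⟨Sum.inl s, fun i => Sum.inl (f i)⟩
    | ⟨Sum.inr y, _⟩ => (Sg.shape Z).map Sum.inr (PFunctor.M.dest (g y))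
  | Sum.inr t => (Sg.shape Z).map Sum.inr (PFunctor.M.dest t)

/-- Substitution: every leaf `y` of `t` is replaced by the tree `g y`. -/
def subst (g : Y.carrier → Tree Sg Z) (t : Tree Sg Y) : Tree Sg Z :=
  PFunctor.M.corec (substStep g) (Sum.inl t)

theorem corec_substStep_inr (g : Y.carrier → Tree Sg Z) (t : Tree Sg Z) :
    PFunctor.M.corec (substStep g) (Sum.inr t) = t := by
  refine PFunctor.M.bisim
    (fun a b => a = PFunctor.M.corec (substStep g) (Sum.inr b)) ?_ _ _ rfl
  rintro _ b rfl
  refine ⟨(PFunctor.M.dest b).1,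
    fun i => PFunctor.M.corec (substStep g) (Sum.inr ((PFunctor.M.dest b).2 i)),
    (PFunctor.M.dest b).2, ?_, rfl, fun i => rfl⟩
  rw [PFunctor.M.dest_corec]
  rfl

theorem subst_leaf (g : Y.carrier → Tree Sg Z) (y : Y.carrier) : subst g (leaf Sg y) = g y := by
  have h : PFunctor.M.dest (subst g (leaf Sg y)) =
      (Sg.shape Z).map (PFunctor.M.corec (substStep g))
        ((Sg.shape Z).map Sum.inr (PFunctor.M.dest (g y))) := PFunctor.M.dest_corec _ _
  rw [PFunctor.map_map] at h
  have h2 : PFunctor.M.corec (substStep g) ∘ Sum.inr = id := funext (corec_substStep_inr g)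
  rw [h2, PFunctor.id_map] at h
  rw [← PFunctor.M.mk_dest (subst g (leaf Sg y)), h, PFunctor.M.mk_dest]

theorem subst_node (g : Y.carrier → Tree Sg Z) (s : Sg.Op.carrier) (f : Sg.Pos s → Tree Sg Y) :
    subst g (node s f) = node s fun i => subst g (f i) := by
  have h : PFunctor.M.dest (subst g (node s f)) =
      (Sg.shape Z).map (PFunctor.M.corec (substStep g))
        ⟨Sum.inl s, fun i => Sum.inl (f i)⟩ := PFunctor.M.dest_corec _ _
  rw [← PFunctor.M.mk_dest (subst g (node s f)), h]
  rfl

theorem eq_of_rel (R : Tree Sg Z → Tree Sg Z → Prop)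
    (h : ∀ x y, R x y → x = y ∨ ∃ s f f', x = node s f ∧ y = node s f' ∧ ∀ i, R (f i) (f' i))
    {x y : Tree Sg Z} (hxy : R x y) : x = y := by
  refine PFunctor.M.bisim (fun a b => a = b ∨ R a b) ?_ x y (Or.inr hxy)
  intro a b hab
  have hab' : a = b ∨ ∃ s f f', a = node s f ∧ b = node s f' ∧ ∀ i, R (f i) (f' i) :=
    hab.elim Or.inl (h a b)
  rcases hab' with rfl | ⟨s, f, f', rfl, rfl, hf⟩
  · exact ⟨(PFunctor.M.dest a).1, (PFunctor.M.dest a).2, (PFunctor.M.dest a).2, rfl, rfl,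
      fun i => Or.inl rfl⟩
  · exact ⟨Sum.inl s, f, f', rfl, rfl, fun i => Or.inr (hf i)⟩

theorem subst_id (t : Tree Sg Y) : subst (leaf Sg) t = t := by
  refine eq_of_rel (fun a b => a = subst (leaf Sg) b) ?_ rfl
  rintro _ b rfl
  rcases leaf_or_node b with ⟨y, rfl⟩ | ⟨s, f, rfl⟩
  · exact Or.inl (subst_leaf _ _)
  · exact Or.inr ⟨s, _, f, subst_node _ _ _, rfl, fun i => rfl⟩

theorem subst_subst (g : X.carrier → Tree Sg Y) (h : Y.carrier → Tree Sg Z) (t : Tree Sg X) :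
    subst h (subst g t) = subst (fun x => subst h (g x)) t := by
  refine eq_of_rel
    (fun a b => ∃ t, a = subst h (subst g t) ∧ b = subst (fun x => subst h (g x)) t) ?_
    ⟨t, rfl, rfl⟩
  rintro _ _ ⟨t, rfl, rfl⟩
  rcases leaf_or_node t with ⟨y, rfl⟩ | ⟨s, f, rfl⟩
  · exact Or.inl (by rw [subst_leaf, subst_leaf])
  · exact Or.inr ⟨s, fun i => subst h (subst g (f i)), fun i => subst (fun x => subst h (g x)) (f i),
      by rw [subst_node, subst_node], by rw [subst_node], fun i => ⟨f i, rfl, rfl⟩⟩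

variable [Fact κ.IsInaccessible]

theorem mk_le : Cardinal.mk (Tree Sg Y) ≤ κ := by
  have hA : Cardinal.mk (Sg.shape Y).A ≤ κ := mk_sum_le Sg.Op.card_le Y.card_le
  have hB : ∀ a, Cardinal.mk ((Sg.shape Y).B a) < κ := by
    rintro (s | y)
    · exact Sg.mk_pos_lt s
    · change Cardinal.mk PEmpty < κ
      rw [Cardinal.mk_pempty]
      exact Cardinal.aleph0_pos.trans_le aleph0_le
  have hC : ∀ n, Cardinal.mk (PFunctor.Approx.CofixA (Sg.shape Y) n) ≤ κ := by
    intro n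
    induction n with
    | zero =>
      have : Subsingleton (PFunctor.Approx.CofixA (Sg.shape Y) 0) :=
        ⟨PFunctor.Approx.cofixA_eq_zero _⟩
      exact (Cardinal.le_one_iff_subsingleton.2 this).trans
        (Cardinal.one_le_aleph0.trans aleph0_le)
    | succ n ih =>
      refine le_trans ?_ (mk_sigma_le hA fun a => mk_fun_le (hB a) ih)
      refine ⟨⟨fun x => ⟨PFunctor.Approx.head' x, PFunctor.Approx.children' x⟩, fun x y h => ?_⟩⟩
      have hs : ∀ z : PFunctor.Approx.CofixA (Sg.shape Y) (n + 1),
          z = (fun p : (Σ a, ((Sg.shape Y).B a → PFunctor.Approx.CofixA (Sg.shape Y) n)) =>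
            PFunctor.Approx.CofixA.intro p.1 p.2)
            ⟨PFunctor.Approx.head' z, PFunctor.Approx.children' z⟩ :=
        PFunctor.Approx.approx_eta
      rw [hs x, hs y]
      exact congrArg (fun p : (Σ a, ((Sg.shape Y).B a → PFunctor.Approx.CofixA (Sg.shape Y) n)) =>
        PFunctor.Approx.CofixA.intro p.1 p.2) h
  have hN : Cardinal.mk (ULift.{u} ℕ) < κ := by
    simpa using (Fact.out (p := κ.IsInaccessible)).aleph0_lt
  refine le_trans ?_ (mk_fun_le hN (mk_sigma_le (A := ULift.{u} ℕ) hN.le fun n => hC n.down))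
  refine ⟨⟨fun t n => ⟨n, t.approx n.down⟩, fun x y h => PFunctor.M.ext' _ x y fun n => ?_⟩⟩
  have := congrFun h ⟨n⟩
  simpa using this

end Tree

variable [Fact κ.IsInaccessible]

/-- The polynomial functor `X ↦ ∐ₛ X ^ ar s`. -/
def poly (Sg : Signature κ) : ClassCat κ ⥤ ClassCat κ where
  obj X := ⟨Σ s : Sg.Op.carrier, (Sg.Pos s → X.carrier),
    mk_sigma_le Sg.Op.card_le fun s => mk_fun_le (Sg.mk_pos_lt s) X.card_le⟩
  map f := fun t => ⟨t.1, fun i => f (t.2 i)⟩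

/-- The class of all `Σ`-trees over `Y`. -/
def treeObj (Sg : Signature κ) (Y : ClassCat κ) : ClassCat κ := ⟨Tree Sg Y, Tree.mk_le⟩

/-- The functor of `Σ`-trees: relabelling of the leaves. -/
def treeFunctor (Sg : Signature κ) : ClassCat κ ⥤ ClassCat κ where
  obj Y := Sg.treeObj Y
  map f := fun t => Tree.subst (fun y => Tree.leaf Sg (f y)) t
  map_id Y := funext fun t => Tree.subst_id (Sg := Sg) (Y := Y) t
  map_comp {X Y Z} f g := by
    funext t
    refine Eq.trans ?_ (Tree.subst_subst _ _ t).symm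
    congr 1
    funext y
    exact (Tree.subst_leaf (Sg := Sg) (Y := Y) (Z := Z) (fun y => Tree.leaf Sg (g y)) (f y)).symm

/-- The `Σ`-tree monad: the unit is the singleton-tree embedding, the multiplication replaces each
leaf, labelled by a tree, by that tree. -/
def treeMonad (Sg : Signature κ) : Monad (ClassCat κ) where
  toFunctor := Sg.treeFunctor
  η :=
    { app := fun _ y => Tree.leaf Sg y
      naturality := fun Y Z f => funext fun y =>
        (Tree.subst_leaf (Sg := Sg) (Y := Y) (Z := Z) (fun y => Tree.leaf Sg (f y)) y).symm }
  μ :=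
    { app := fun Y t => Tree.subst (Y := Sg.treeObj Y) (fun s => s) t
      naturality := fun Y Z f => by
        funext t
        refine (Tree.subst_subst (Y := Sg.treeObj Z) _ _ t).trans ?_
        refine Eq.trans ?_ (Tree.subst_subst (X := Sg.treeObj Y) _ _ t).symm
        congr 1
        funext y
        exact Tree.subst_leaf _ _ }
  assoc Y := by
    funext t
    refine (Tree.subst_subst (Y := Sg.treeObj Y) _ _ t).trans ?_
    refine Eq.trans ?_ (Tree.subst_subst (X := Sg.treeObj (Sg.treeObj Y)) (Y := Sg.treeObj Y)
      _ _ t).symm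
    congr 1
    funext y
    exact Tree.subst_leaf _ _
  left_unit Y := funext fun t => Tree.subst_leaf (Y := Sg.treeObj Y) _ t
  right_unit Y := by
    funext t
    refine (Tree.subst_subst (Y := Sg.treeObj Y) _ _ t).trans ?_
    refine Eq.trans ?_ (Tree.subst_id t)
    congr 1
    funext y
    exact Tree.subst_leaf _ _

/-- The arrow `H_Σ ⟶ T_Σ` sending an operation symbol with a tuple of variables to the
corresponding flat tree. -/
def flat (Sg : Signature κ) : Sg.poly ⟶ Sg.treeMonad.toFunctor where
  app Y := fun t => Tree.node (Y := Y) t.1 fun i => Tree.leaf Sg (t.2 i)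
  naturality Y Z f := by
    funext t
    refine Eq.trans ?_ (Tree.subst_node (Y := Y) _ _ _).symm
    change Tree.node (Y := Z) _ _ = Tree.node (Y := Z) _ _
    congr 1
    funext i
    exact (Tree.subst_leaf (Sg := Sg) (Y := Y) (Z := Z)
      (fun y => Tree.leaf Sg (f y)) (t.2 i)).symm

end Signature

/-! The key fact is that every endofunctor `H` of classes is set-based: each element of `H X` comes
from a small domain (`exists_segment`). It is proved by counting: an element of `H` of the ordinals
below `κ` is pushed along `2 ^ κ` almost disjoint branch maps into a single class, so two of the
results coincide, and a retraction of one branch map then shows that the element has small support.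
Consequently `H` is a quotient of a polynomial functor `H_Σ` (`presentation`).

Given `ε : H_Σ ⟶ H` with surjective components, the `Σ`-trees over `Y` form a weakly terminal
coalgebra of `H(-) + Y`: a section of `ε` at one class lifts a coalgebra to `H_Σ(-) + Y`, which
unfolds into trees. Dividing by the greatest congruence makes the coalgebra terminal
(`hasTerminal_of_weaklyTerminal`).

By Lambek's lemma the terminal coalgebra `TY` decomposes as `HTY + Y`. Corecursion with substitution
(`corecSubst`) gives unique homomorphic extensions into `TY`, hence the Kleisli structure of a
monad. Guarded equations are solved by corecursion on the whole of `T(X + Y)`. Conversely, in any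
completely iterative monad `S` the homomorphisms out of an algebra `A = HA + Y` are exactly the
solutions of one guarded equation, and this yields freeness.

Evaluation of trees is the homomorphic extension of the unit of `T`. It is a split epimorphism on
components, because weak terminality supplies a coalgebra map from `TY` to the trees, and the
composite endomorphism of the terminal `TY` is the identity. -/

namespace ClassCat

variable {κ : Cardinal.{u}}

theorem map_map_apply (H : ClassCat κ ⥤ ClassCat κ) {X Y Z : ClassCat κ} (f : X ⟶ Y) (g : Y ⟶ Z)
    (x : (H.obj X).carrier) : H.map g (H.map f x) = H.map (f ≫ g) x :=
  (congrFun (H.map_comp f g) x).symm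

theorem epi_of_surjective {X Y : ClassCat κ} {f : X ⟶ Y} (hf : Function.Surjective f) : Epi f :=
  ⟨fun g h hgh => funext fun y => by obtain ⟨x, rfl⟩ := hf y; exact congrFun hgh x⟩

theorem mk_Iio_lt (a : κ.ord.ToType) : Cardinal.mk (Set.Iio a) < κ := by
  simpa using Cardinal.mk_Iio_lt a

/-! ## Every endofunctor of the category of classes is set-based -/

/-- The proper initial segments of the well-order of type `κ`. -/
def segment (a : κ.ord.ToType) : ClassCat κ := ⟨Set.Iio a, (mk_Iio_lt a).le⟩

/-- Every small type is equinumerous with a proper initial segment of `κ`. -/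
theorem exists_equiv_segment {A : Type u} (hA : Cardinal.mk A < κ) :
    ∃ a : κ.ord.ToType, Nonempty (A ≃ Set.Iio a) := by
  have ho : (Cardinal.mk A).ord < κ.ord := Cardinal.ord_lt_ord.2 hA
  let a : κ.ord.ToType := Ordinal.ToType.mk ⟨(Cardinal.mk A).ord, ho⟩
  have ha : Ordinal.typein (α := κ.ord.ToType) (· < ·) a = (Cardinal.mk A).ord :=
    Ordinal.typein_enum _ _
  refine ⟨a, Cardinal.eq.1 ?_⟩
  have h := Ordinal.card_typein (α := κ.ord.ToType) (r := (· < ·)) a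
  rw [ha, Cardinal.card_ord] at h
  exact h

/-- The range of a map with small range supports all elements in the image of that map. -/
theorem exists_segment_of_small_range (H : ClassCat κ ⥤ ClassCat κ) {Z X : ClassCat κ} (u : Z ⟶ X)
    (hu : Cardinal.mk (Set.range u) < κ) (z : (H.obj Z).carrier) :
    ∃ (a : κ.ord.ToType) (f : segment a ⟶ X) (y : (H.obj (segment a)).carrier),
      H.map f y = H.map u z := by
  obtain ⟨a, ⟨e⟩⟩ := exists_equiv_segment hu
  let p : Z ⟶ segment a := fun z => e ⟨u z, z, rfl⟩
  let f : segment a ⟶ X := fun i => (e.symm i).1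
  refine ⟨a, f, H.map p z, ?_⟩
  rw [map_map_apply]
  refine congrArg (fun v => H.map v z) (funext fun z => ?_)
  exact congrArg Subtype.val (e.symm_apply_apply ⟨u z, z, rfl⟩)

variable [hκ : Fact κ.IsInaccessible]

/-- The class of all `κ`-small branches through the binary tree of height `κ`. -/
def branches (κ : Cardinal.{u}) [Fact κ.IsInaccessible] : ClassCat κ :=
  ⟨Σ a : κ.ord.ToType, (Set.Iio a → ULift.{u} Bool),
    mk_sigma_le (by simp) fun a => mk_fun_le (mk_Iio_lt a)
      ((Cardinal.lt_aleph0_of_finite _).le.trans aleph0_le)⟩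

/-- The class of all ordinals below `κ`. -/
def ordinals (κ : Cardinal.{u}) : ClassCat κ := ⟨κ.ord.ToType, by simp⟩

/-- The branch of the binary tree of height `κ` given by `f`. These maps form an almost disjoint
family. -/
def branch (f : κ.ord.ToType → ULift.{u} Bool) : ordinals κ ⟶ branches κ :=
  fun a => ⟨a, fun i => f i⟩

theorem exists_segment_ordinals (H : ClassCat κ ⥤ ClassCat κ) (x : (H.obj (ordinals κ)).carrier) :
    ∃ (a : κ.ord.ToType) (f : segment a ⟶ ordinals κ) (y : (H.obj (segment a)).carrier),
      H.map f y = x := by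
  classical
  have hni : ¬ Function.Injective
      -- There are `2 ^ κ` branch maps, but `H` of the class of branches has at most `κ` elements.
      fun f : κ.ord.ToType → ULift.{u} Bool => H.map (branch f) x := by
    intro hi
    have h1 := (Cardinal.mk_le_of_injective hi).trans (H.obj (branches κ)).card_le
    have h2 : Cardinal.mk (κ.ord.ToType → ULift.{u} Bool) = 2 ^ κ := by simp
    exact absurd (Cardinal.cantor κ) (not_lt.2 (h2 ▸ h1))
  simp only [Function.Injective, not_forall] at hni
  obtain ⟨f, g, hfg, hne⟩ := hni
  obtain ⟨d, hd⟩ := Function.ne_iff.1 hne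
  -- `r` inverts `branch f`. A branch that is not a restriction of `f` goes to `d`, where `f` and
  -- `g` differ, so after `branch g` only values up to `d` occur.
  let r : branches κ ⟶ ordinals κ :=
    fun p => if p.2 = (fun i : Set.Iio p.1 => f i) then p.1 else d
  have hrf : branch f ≫ r = 𝟙 _ := by
    funext a
    exact if_pos rfl
  have hx : H.map (branch g ≫ r) x = x := by
    rw [← map_map_apply, ← hfg, map_map_apply, hrf, H.map_id, id_apply]
  have hsub : Set.range (branch g ≫ r) ⊆ (insert d (Set.Iio d) : Set κ.ord.ToType) := by
    rintro _ ⟨a : κ.ord.ToType, rfl⟩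
    by_cases h : (fun i : Set.Iio a => g i) = fun i : Set.Iio a => f i
    · rw [show (branch g ≫ r) a = a from if_pos h]
      by_contra hc
      have hda : d < a := lt_of_not_ge fun hle => hc (hle.eq_or_lt.elim Or.inl Or.inr)
      exact hd (congrFun h ⟨d, hda⟩).symm
    · rw [show (branch g ≫ r) a = d from if_neg h]
      exact Set.mem_insert _ _
  have hlt : Cardinal.mk (Set.range (branch g ≫ r)) < κ :=
    ((Cardinal.mk_le_mk_of_subset hsub).trans Cardinal.mk_insert_le).trans_lt
      (Cardinal.add_lt_of_lt aleph0_le (mk_Iio_lt d)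
        (Cardinal.one_lt_aleph0.trans_le aleph0_le))
  obtain ⟨a, f, y, hy⟩ := exists_segment_of_small_range H _ hlt x
  exact ⟨a, f, y, hy.trans hx⟩

/-- Every endofunctor `H` of the category of classes is set-based: each element of `H X` lies in
the image of `H f` for some map `f` with small domain. -/
theorem exists_segment (H : ClassCat κ ⥤ ClassCat κ) (X : ClassCat κ) (x : (H.obj X).carrier) :
    ∃ (a : κ.ord.ToType) (f : segment a ⟶ X) (y : (H.obj (segment a)).carrier),
      H.map f y = x := by
  rcases X.card_le.lt_or_eq with hlt | heq
  · obtain ⟨a, f, y, hy⟩ := exists_segment_of_small_range H (𝟙 X)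
      (Cardinal.mk_range_le.trans_lt hlt) x
    exact ⟨a, f, y, by rw [hy, H.map_id, id_apply]⟩
  · obtain ⟨e⟩ : Nonempty (X.carrier ≃ κ.ord.ToType) := Cardinal.eq.1 (by simpa using heq)
    let p : X ⟶ ordinals κ := fun x => e x
    let q : ordinals κ ⟶ X := fun a => e.symm a
    have hpq : p ≫ q = 𝟙 X := funext fun x => e.symm_apply_apply x
    obtain ⟨a, f, y, hy⟩ := exists_segment_ordinals H (H.map p x)
    exact ⟨a, f ≫ q, y, by
      rw [← map_map_apply, hy, map_map_apply, hpq, H.map_id, id_apply]⟩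

/-- The constantly true predicate and membership in the range agree after composition with `f`. -/
theorem surjective_of_epi {X Y : ClassCat κ} (f : X ⟶ Y) [Epi f] : Function.Surjective f := by
  intro y
  by_contra hy
  let P : ClassCat κ :=
    ⟨ULift.{u} Prop, (Cardinal.lt_aleph0_of_finite _).le.trans aleph0_le⟩
  let g : Y ⟶ P := fun _ => ⟨True⟩
  let h : Y ⟶ P := fun z => ⟨∃ x, f x = z⟩
  have hgh : g = h := by
    rw [← cancel_epi f]
    funext x
    exact congrArg ULift.up (eq_true ⟨x, rfl⟩).symm
  exact hy ((congrArg ULift.down (congrFun hgh y)).mp trivial)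

end ClassCat

/-! ### The canonical presentation of an endofunctor by operation symbols -/

namespace Signature

variable {κ : Cardinal.{u}} [Fact κ.IsInaccessible]

/-- The canonical signature of an endofunctor `H`: the operation symbols of arity `a` are the
elements of `H a`, for `a` ranging through the initial segments of `κ`. -/
def ofFunctor (H : ClassCat κ ⥤ ClassCat κ) : Signature κ where
  Op := ⟨Σ a : κ.ord.ToType, (H.obj (segment a)).carrier,
    mk_sigma_le (by simp) fun a => (H.obj (segment a)).card_le⟩
  ar s := Cardinal.mk (Set.Iio s.1)
  ar_lt s := mk_Iio_lt s.1

/-- An arity is a cardinal, so the positions form its initial ordinal, which need not be the given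
segment. A chosen bijection depends on the symbol alone, hence does not disturb naturality. -/
theorem nonempty_equiv_pos_ofFunctor (H : ClassCat κ ⥤ ClassCat κ)
    (s : (ofFunctor H).Op.carrier) : Nonempty (Set.Iio s.1 ≃ (ofFunctor H).Pos s) :=
  Cardinal.eq.1 (Cardinal.mk_ord_toType _).symm

/-- The canonical presentation of `H` as a quotient of a polynomial functor. -/
noncomputable def presentation (H : ClassCat κ ⥤ ClassCat κ) : (ofFunctor H).poly ⟶ H where
  app X := fun t =>
    H.map (X := segment t.1.1) (fun i => t.2 ((nonempty_equiv_pos_ofFunctor H t.1).some i)) t.1.2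
  naturality X Y f := by
    funext t
    exact (map_map_apply H (X := segment t.1.1) _ f t.1.2).symm

theorem epi_presentation_app (H : ClassCat κ ⥤ ClassCat κ) (X : ClassCat κ) :
    Epi ((presentation H).app X) := by
  refine epi_of_surjective fun x => ?_
  obtain ⟨a, f, y, rfl⟩ := exists_segment H X x
  refine ⟨⟨⟨a, y⟩, fun p => f ((nonempty_equiv_pos_ofFunctor H ⟨a, y⟩).some.symm p)⟩, ?_⟩
  refine congrArg (fun g => H.map g y) (funext fun i => ?_)
  exact congrArg f (Equiv.symm_apply_apply _ _)

end Signature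

namespace ClassCat

/-! ## Terminal coalgebras as quotients of weakly terminal ones -/

section Quotient

variable {κ : Cardinal.{u}} {G : ClassCat κ ⥤ ClassCat κ}

/-- The quotient of a class. -/
def quot (W : ClassCat κ) (E : Setoid W.carrier) : ClassCat κ :=
  ⟨Quotient E, Cardinal.mk_quotient_le.trans W.card_le⟩

/-- The quotient map. -/
def quotMap (W : ClassCat κ) (E : Setoid W.carrier) : W ⟶ quot W E := fun w => Quotient.mk E w

/-- The factorization of `f : W ⟶ Z` through the quotient by a relation contained in its kernel. -/
def quotLift {W Z : ClassCat κ} (E : Setoid W.carrier) (f : W ⟶ Z) (h : ∀ a b, E a b → f a = f b) :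
    quot W E ⟶ Z :=
  fun q => Quotient.lift (s := E) f h q

/-- An equivalence relation on a coalgebra is a congruence if the coalgebra structure descends
to the quotient. -/
def IsCongruence (W : Endofunctor.Coalgebra G) (E : Setoid W.V.carrier) : Prop :=
  ∀ a b, E a b → (W.str ≫ G.map (quotMap W.V E)) a = (W.str ≫ G.map (quotMap W.V E)) b

/-- The greatest congruence. -/
def greatestCongruence (W : Endofunctor.Coalgebra G) : Setoid W.V.carrier :=
  sSup {E | IsCongruence W E}

/-- The quotient by the supremum factors through the quotient by each congruence `E`. So `E` lies in
the kernel of the structure followed by `G` of the larger quotient map, and this kernel therefore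
bounds the supremum. -/
theorem isCongruence_greatestCongruence (W : Endofunctor.Coalgebra G) :
    IsCongruence W (greatestCongruence W) := by
  suffices h : greatestCongruence W ≤
      Setoid.ker (W.str ≫ G.map (quotMap W.V (greatestCongruence W))) from fun a b hab => h hab
  refine sSup_le fun E hE a b hab => ?_
  have hle : E ≤ greatestCongruence W := le_sSup hE
  let p : quot W.V E ⟶ quot W.V (greatestCongruence W) :=
    quotLift E (quotMap W.V (greatestCongruence W)) fun a b h => Quotient.sound (hle h)
  have hp : W.str ≫ G.map (quotMap W.V (greatestCongruence W)) =
      (W.str ≫ G.map (quotMap W.V E)) ≫ G.map p := by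
    rw [Category.assoc, ← G.map_comp]
    rfl
  rw [Setoid.ker_def, hp]
  exact congrArg (G.map p) (hE a b hab)

/-- The quotient of a coalgebra by its greatest congruence. -/
def simpleQuotient (W : Endofunctor.Coalgebra G) : Endofunctor.Coalgebra G where
  V := quot W.V (greatestCongruence W)
  str := quotLift _ (W.str ≫ G.map (quotMap W.V (greatestCongruence W)))
    (isCongruence_greatestCongruence W)

/-- Any two parallel homomorphisms into the simple quotient agree. -/
theorem simpleQuotient_hom_ext (W : Endofunctor.Coalgebra G) {Z : Endofunctor.Coalgebra G}
    (f g : Z ⟶ simpleQuotient W) : f = g := by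
  let p := quotMap W.V (greatestCongruence W)
  -- `q` is the coequalizer of `f` and `g`. The structure descends along it, so its pullback to `W`
  -- is a congruence, contained in the greatest one, and `q` identifies nothing new. No preservation
  -- property of `G` is needed.
  let E : Setoid (simpleQuotient W).V.carrier :=
    Relation.EqvGen.setoid fun a b => ∃ z, f.f z = a ∧ g.f z = b
  let q := quotMap (simpleQuotient W).V E
  have hq : f.f ≫ q = g.f ≫ q :=
    funext fun z => Quotient.sound (s := E) (Relation.EqvGen.rel _ _ ⟨z, rfl, rfl⟩)
  have hE : E ≤ Setoid.ker ((simpleQuotient W).str ≫ G.map q) := by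
    refine Setoid.eqvGen_le ?_
    rintro _ _ ⟨z, rfl, rfl⟩
    have h : f.f ≫ (simpleQuotient W).str ≫ G.map q = g.f ≫ (simpleQuotient W).str ≫ G.map q := by
      rw [← Category.assoc, ← Category.assoc, ← f.h, ← g.h, Category.assoc, Category.assoc,
        ← G.map_comp, ← G.map_comp, hq]
    exact congrFun h z
  let E' : Setoid W.V.carrier := Setoid.ker (p ≫ q)
  have hE' : IsCongruence W E' := by
    -- The iterated quotient maps back to the single quotient by `E'`, which transfers compatibility
    -- with the structure from `q` to `E'`.
    let j : quot (simpleQuotient W).V E ⟶ quot W.V E' :=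
      quotLift E (quotLift _ (quotMap W.V E') fun a b hab => Quotient.sound (s := E')
        (congrArg q (Quotient.sound hab))) fun a b => by
          refine Quotient.inductionOn₂ a b fun a b hab => ?_
          exact Quotient.sound (s := E') (Quotient.sound hab)
    have hj : p ≫ q ≫ j = quotMap W.V E' := rfl
    have h : W.str ≫ G.map (quotMap W.V E') =
        p ≫ ((simpleQuotient W).str ≫ G.map q) ≫ G.map j := by
      rw [← hj, G.map_comp]
      exact congrArg (fun m => W.str ≫ G.map p ≫ m) (G.map_comp q j)
    intro a b hab
    rw [h]
    exact congrArg (G.map j) (hE (Quotient.exact (s := E) hab))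
  have hle : E' ≤ greatestCongruence W := le_sSup hE'
  refine Endofunctor.Coalgebra.ext (funext fun z => ?_)
  obtain ⟨a, ha⟩ := Quotient.exists_rep (f.f z)
  obtain ⟨b, hb⟩ := Quotient.exists_rep (g.f z)
  rw [← ha, ← hb]
  refine Quotient.sound (hle ?_)
  change q (Quotient.mk _ a) = q (Quotient.mk _ b)
  rw [ha, hb]
  exact congrFun hq z

/-- An endofunctor with a weakly terminal coalgebra has a terminal coalgebra. -/
theorem hasTerminal_of_weaklyTerminal (W : Endofunctor.Coalgebra G)
    (hW : ∀ Z : Endofunctor.Coalgebra G, Nonempty (Z ⟶ W)) :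
    HasTerminal (Endofunctor.Coalgebra G) := by
  let p : W ⟶ simpleQuotient W := ⟨quotMap W.V (greatestCongruence W), rfl⟩
  exact (IsTerminal.ofUniqueHom (fun Z => (hW Z).some ≫ p)
    fun Z m => simpleQuotient_hom_ext W _ _).hasTerminal

end Quotient

end ClassCat

/-! ### Weak terminality of the coalgebra of trees -/

namespace Signature

variable {κ : Cardinal.{u}} [Fact κ.IsInaccessible] {Sg : Signature κ}

/-- The decomposition of trees: the terminal coalgebra structure of `H_Σ(-) + Y`. -/
def Tree.split (Sg : Signature κ) (Y : ClassCat κ) :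
    Sg.treeObj Y ⟶ sum (Sg.poly.obj (Sg.treeObj Y)) Y :=
  fun t => match PFunctor.M.dest t with
    | ⟨Sum.inl s, f⟩ => Sum.inl ⟨s, f⟩
    | ⟨Sum.inr y, _⟩ => Sum.inr y

theorem Tree.exists_split_hom {Y Z : ClassCat κ} (c : Z ⟶ sum (Sg.poly.obj Z) Y) :
    ∃ k : Z ⟶ Sg.treeObj Y, c ≫ (plus Sg.poly Y).map k = k ≫ Tree.split Sg Y := by
  let st : Z.carrier → (Sg.shape Y) Z.carrier := fun z =>
    match c z with
    | Sum.inl ⟨s, f⟩ => ⟨Sum.inl s, f⟩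
    | Sum.inr y => ⟨Sum.inr y, fun i => PEmpty.elim i⟩
  let k : Z ⟶ Sg.treeObj Y := fun z => PFunctor.M.corec st z
  refine ⟨k, funext fun z => ?_⟩
  have h : PFunctor.M.dest (k z) = (Sg.shape Y).map k (st z) := PFunctor.M.dest_corec _ _
  change (plus Sg.poly Y).map k (c z) = Tree.split Sg Y (k z)
  unfold Tree.split
  rw [h]
  simp only [st]
  rcases c z with ⟨s, f⟩ | y <;> rfl

/-- The coalgebra for `H(-) + Y` on the class of trees, given by `ε : H_Σ ⟶ H`. -/
def treeCoalgebra {H : ClassCat κ ⥤ ClassCat κ} (ε : Sg.poly ⟶ H) (Y : ClassCat κ) :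
    Endofunctor.Coalgebra (plus H Y) where
  V := Sg.treeObj Y
  str := Tree.split Sg Y ≫ sumMap (ε.app _) (𝟙 Y)

/-- Choosing a preimage under `ε` at `Z` alone turns the coalgebra into one for `H_Σ(-) + Y`. The
section need not be natural: naturality of `ε` suffices to make the unfolding into trees a
homomorphism. -/
theorem treeCoalgebra_weaklyTerminal {H : ClassCat κ ⥤ ClassCat κ} (ε : Sg.poly ⟶ H)
    (hε : ∀ X, Epi (ε.app X)) (Y : ClassCat κ) (Z : Endofunctor.Coalgebra (plus H Y)) :
    Nonempty (Z ⟶ treeCoalgebra ε Y) := by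
  have hs : Function.Surjective (sumMap (ε.app Z.V) (𝟙 Y)) := by
    rintro (x | y)
    · obtain ⟨t, rfl⟩ := surjective_of_epi (ε.app Z.V) x
      exact ⟨Sum.inl t, rfl⟩
    · exact ⟨Sum.inr y, rfl⟩
  choose d hd using hs
  let c : Z.V ⟶ sum (Sg.poly.obj Z.V) Y := fun z => d (Z.str z)
  have hc : c ≫ sumMap (ε.app Z.V) (𝟙 Y) = Z.str := funext fun z => hd _
  obtain ⟨k, hk⟩ := Tree.exists_split_hom c
  refine ⟨⟨k, ?_⟩⟩
  have h : sumMap (ε.app Z.V) (𝟙 Y) ≫ sumMap (H.map k) (𝟙 Y) =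
      sumMap (Sg.poly.map k) (𝟙 Y) ≫ sumMap (ε.app (Sg.treeObj Y)) (𝟙 Y) := by
    funext x
    rcases x with x | y
    · exact congrArg Sum.inl (congrFun (ε.naturality k) x).symm
    · rfl
  calc Z.str ≫ sumMap (H.map k) (𝟙 Y)
      = c ≫ sumMap (ε.app Z.V) (𝟙 Y) ≫ sumMap (H.map k) (𝟙 Y) :=
        (congrArg (· ≫ sumMap (H.map k) (𝟙 Y)) hc).symm
    _ = (c ≫ sumMap (Sg.poly.map k) (𝟙 Y)) ≫ sumMap (ε.app (Sg.treeObj Y)) (𝟙 Y) := by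
        rw [h, Category.assoc]
    _ = (k ≫ Tree.split Sg Y) ≫ sumMap (ε.app (Sg.treeObj Y)) (𝟙 Y) :=
        congrArg (· ≫ sumMap (ε.app (Sg.treeObj Y)) (𝟙 Y)) hk

theorem hasTerminal_coalgebra_plus (H : ClassCat κ ⥤ ClassCat κ) (Y : ClassCat κ) :
    HasTerminal (Endofunctor.Coalgebra (plus H Y)) :=
  hasTerminal_of_weaklyTerminal _
    (treeCoalgebra_weaklyTerminal (presentation H) (epi_presentation_app H) Y)

end Signature

namespace ClassCat

variable {κ : Cardinal.{u}} [hκ : Fact κ.IsInaccessible]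

/-! ## Calculus of binary coproducts of classes -/

theorem inl_desc {X Y Z : ClassCat κ} (f : X ⟶ Z) (g : Y ⟶ Z) : inl X Y ≫ desc f g = f := rfl

theorem inr_desc {X Y Z : ClassCat κ} (f : X ⟶ Z) (g : Y ⟶ Z) : inr X Y ≫ desc f g = g := rfl

theorem sum_hom_ext {X Y Z : ClassCat κ} {f g : sum X Y ⟶ Z} (h1 : inl X Y ≫ f = inl X Y ≫ g)
    (h2 : inr X Y ≫ f = inr X Y ≫ g) : f = g := by
  funext x
  rcases x with x | y
  · exact congrFun h1 x
  · exact congrFun h2 y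

theorem desc_comp {X Y Z W : ClassCat κ} (f : X ⟶ Z) (g : Y ⟶ Z) (h : Z ⟶ W) :
    desc f g ≫ h = desc (f ≫ h) (g ≫ h) := sum_hom_ext rfl rfl

theorem sumMap_desc {X Y X' Y' Z : ClassCat κ} (f : X ⟶ X') (g : Y ⟶ Y') (h : X' ⟶ Z)
    (k : Y' ⟶ Z) : sumMap f g ≫ desc h k = desc (f ≫ h) (g ≫ k) := sum_hom_ext rfl rfl

/-! ## Cofree coalgebras -/

/-- The morphisms `τ : H T ⟶ T` and `η : Y ⟶ T` exhibit `T` as the coproduct `H T + Y` and, via the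
inverse of `[τ, η]`, as a terminal coalgebra of `H(-) + Y`. -/
structure IsCofree (H : ClassCat κ ⥤ ClassCat κ) {T Y : ClassCat κ} (τ : H.obj T ⟶ T) (η : Y ⟶ T) :
    Prop where
  isIso_desc : IsIso (desc τ η)
  corec : ∀ (Z : ClassCat κ) (c : Z ⟶ sum (H.obj Z) Y),
    ∃! k : Z ⟶ T, k = c ≫ desc (H.map k ≫ τ) η

namespace IsCofree

variable {H : ClassCat κ ⥤ ClassCat κ}

theorem hom_eq_iff {T Y : ClassCat κ} {τ : H.obj T ⟶ T} {η : Y ⟶ T} (hi : IsIso (desc τ η))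
    {V : ClassCat κ} (c : V ⟶ sum (H.obj V) Y) (k : V ⟶ T) :
    c ≫ sumMap (H.map k) (𝟙 Y) = k ≫ inv (desc τ η) ↔ k = c ≫ desc (H.map k ≫ τ) η := by
  rw [IsIso.eq_comp_inv, Category.assoc, sumMap_desc, Category.id_comp, eq_comm]

theorem of_isTerminal {T Y : ClassCat κ} {τ : H.obj T ⟶ T} {η : Y ⟶ T} (hi : IsIso (desc τ η))
    (h : IsTerminal (⟨T, @inv _ _ _ _ (desc τ η) hi⟩ : Endofunctor.Coalgebra (plus H Y))) :
    IsCofree H τ η where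
  isIso_desc := hi
  corec Z c := by
    refine ⟨(h.from (⟨Z, c⟩ : Endofunctor.Coalgebra (plus H Y))).f,
      (hom_eq_iff hi c _).1 (h.from (⟨Z, c⟩ : Endofunctor.Coalgebra (plus H Y))).h, fun k hk => ?_⟩
    exact congrArg Endofunctor.Coalgebra.Hom.f
      (h.hom_ext (Y := (⟨Z, c⟩ : Endofunctor.Coalgebra (plus H Y)))
        (Endofunctor.Coalgebra.Hom.mk k ((hom_eq_iff hi c k).2 hk)) (h.from _))

theorem nonempty_isTerminal {T Y : ClassCat κ} {τ : H.obj T ⟶ T} {η : Y ⟶ T}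
    (h : IsCofree H τ η) (hi : IsIso (desc τ η)) :
    Nonempty (IsTerminal (⟨T, @inv _ _ _ _ (desc τ η) hi⟩ : Endofunctor.Coalgebra (plus H Y))) :=
  ⟨IsTerminal.ofUniqueHom
    (fun V => ⟨(h.corec V.V V.str).choose,
      (hom_eq_iff hi V.str _).2 (h.corec V.V V.str).choose_spec.1⟩)
    (fun V m => Endofunctor.Coalgebra.ext
      ((h.corec V.V V.str).choose_spec.2 m.f ((hom_eq_iff hi V.str _).1 m.h)))⟩

/-- Lambek's lemma: the structure of the terminal coalgebra is invertible, and `τ` and `η` are the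
two components of its inverse. -/
theorem exists_isCofree (H : ClassCat κ ⥤ ClassCat κ) (Y : ClassCat κ) :
    ∃ (T : ClassCat κ) (τ : H.obj T ⟶ T) (η : Y ⟶ T), IsCofree H τ η := by
  have := Signature.hasTerminal_coalgebra_plus H Y
  let A := ⊤_ (Endofunctor.Coalgebra (plus H Y))
  have hA : IsTerminal A := terminalIsTerminal
  let d : sum (H.obj A.V) Y ⟶ A.V := Endofunctor.Coalgebra.Terminal.strInv hA
  have h1 : A.str ≫ d = 𝟙 _ := Endofunctor.Coalgebra.Terminal.right_inv hA
  have h2 : d ≫ A.str = 𝟙 _ := Endofunctor.Coalgebra.Terminal.left_inv hA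
  have hd : desc (inl (H.obj A.V) Y ≫ d) (inr (H.obj A.V) Y ≫ d) = d := sum_hom_ext rfl rfl
  have hi : IsIso (desc (inl (H.obj A.V) Y ≫ d) (inr (H.obj A.V) Y ≫ d)) := by
    rw [hd]
    exact ⟨A.str, h2, h1⟩
  refine ⟨A.V, inl (H.obj A.V) Y ≫ d, inr (H.obj A.V) Y ≫ d, of_isTerminal hi ?_⟩
  have hs : @inv _ _ _ _ (desc (inl (H.obj A.V) Y ≫ d) (inr (H.obj A.V) Y ≫ d)) hi = A.str :=
    IsIso.inv_eq_of_hom_inv_id (by rw [hd]; exact h2)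
  have hc : (⟨A.V, @inv _ _ _ _ (desc (inl (H.obj A.V) Y ≫ d) (inr (H.obj A.V) Y ≫ d)) hi⟩ :
      Endofunctor.Coalgebra (plus H Y)) = A :=
    congrArg (fun s => (⟨A.V, s⟩ : Endofunctor.Coalgebra (plus H Y))) hs
  exact Eq.mpr (congrArg IsTerminal hc) hA

section

variable {T Y : ClassCat κ} {τ : H.obj T ⟶ T} {η : Y ⟶ T} (h : IsCofree H τ η)

include h

theorem corec_unique {Z : ClassCat κ} (c : Z ⟶ sum (H.obj Z) Y) {k k' : Z ⟶ T}
    (hk : k = c ≫ desc (H.map k ≫ τ) η) (hk' : k' = c ≫ desc (H.map k' ≫ τ) η) : k = k' :=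
  (h.corec Z c).unique hk hk'

/-- Corecursion with substitution: a coalgebra with variables in `X` and an interpretation
`f : X ⟶ T` of the variables have a unique solution in `T`. -/
theorem corecSubst {Z X : ClassCat κ} (c : Z ⟶ sum (H.obj Z) X) (f : X ⟶ T) :
    ∃! k : Z ⟶ T, k = c ≫ desc (H.map k ≫ τ) f := by
  have := h.isIso_desc
  let a := inv (desc τ η)
  have ha : a ≫ desc τ η = 𝟙 T := IsIso.inv_hom_id _
  let j : T ⟶ sum (H.obj (sum Z T)) Y := a ≫ sumMap (H.map (inr Z T)) (𝟙 Y)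
  let D : sum Z T ⟶ sum (H.obj (sum Z T)) Y :=
    desc (c ≫ desc (H.map (inl Z T) ≫ inl _ _) (f ≫ j)) j
  have hj : ∀ k : sum Z T ⟶ T, j ≫ desc (H.map k ≫ τ) η =
      a ≫ desc (H.map (inr Z T ≫ k) ≫ τ) η := fun k => by
    simp only [j, Category.assoc, sumMap_desc, Category.id_comp, H.map_comp]
  have hD : ∀ k : sum Z T ⟶ T, inr Z T ≫ k = 𝟙 T → j ≫ desc (H.map k ≫ τ) η = 𝟙 T := fun k hk => by
    rw [hj, hk, H.map_id, Category.id_comp, ha]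
  have hD' : ∀ k : sum Z T ⟶ T, inr Z T ≫ k = 𝟙 T →
      inl Z T ≫ D ≫ desc (H.map k ≫ τ) η = c ≫ desc (H.map (inl Z T ≫ k) ≫ τ) f := fun k hk => by
    simp only [D, Category.assoc, desc_comp, inl_desc, hD k hk, H.map_comp,
      Category.comp_id]
  obtain ⟨k, hk, hu⟩ := h.corec _ D
  have hr : inr Z T ≫ k = 𝟙 T := by
    refine h.corec_unique a ?_ (by rw [H.map_id, Category.id_comp, ha])
    exact (congrArg (inr Z T ≫ ·) hk).trans (hj k)
  refine ⟨inl Z T ≫ k, ?_, fun m hm => ?_⟩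
  · exact (congrArg (inl Z T ≫ ·) hk).trans (hD' k hr)
  · rw [← hu (desc m (𝟙 T)) ?_, inl_desc]
    refine sum_hom_ext ?_ ?_
    · rw [hD' _ (inr_desc _ _), inl_desc]
      exact hm
    · exact (hD (desc m (𝟙 T)) (inr_desc _ _)).symm

/-- A cofree coalgebra on `X` is a free completely iterative algebra: morphisms from `X` to `T`
extend uniquely to algebra homomorphisms. -/
theorem existsUnique_extension {S X : ClassCat κ} {τ' : H.obj S ⟶ S} {η' : X ⟶ S}
    [IsIso (desc τ' η')] (f : X ⟶ T) :
    ∃! k : S ⟶ T, τ' ≫ k = H.map k ≫ τ ∧ η' ≫ k = f := by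
  have key : ∀ k : S ⟶ T, (τ' ≫ k = H.map k ≫ τ ∧ η' ≫ k = f) ↔
      k = inv (desc τ' η') ≫ desc (H.map k ≫ τ) f := fun k => by
    rw [IsIso.eq_inv_comp, desc_comp]
    exact ⟨fun h => by rw [h.1, h.2], fun h => ⟨congrArg (inl _ _ ≫ ·) h, congrArg (inr _ _ ≫ ·) h⟩⟩
  simp only [key]
  exact h.corecSubst _ f

/-- The source need only decompose as `H S + X`; cofreeness is used for the target alone. The monad
laws are reduced to this. -/
theorem hom_ext {S X : ClassCat κ} {τ' : H.obj S ⟶ S} {η' : X ⟶ S} [IsIso (desc τ' η')]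
    {k k' : S ⟶ T} (hk : τ' ≫ k = H.map k ≫ τ) (hk' : τ' ≫ k' = H.map k' ≫ τ)
    (hη : η' ≫ k = η' ≫ k') : k = k' :=
  (h.existsUnique_extension (η' ≫ k')).unique ⟨hk, hη⟩ ⟨hk', rfl⟩

end

end IsCofree

end ClassCat

/-! ## The monad of cofree coalgebras -/

section Generated

variable {κ : Cardinal.{u}} [Fact κ.IsInaccessible] {H : ClassCat κ ⥤ ClassCat κ}

/-- A choice of cofree coalgebras generates a monad. -/
theorem ClassCat.IsCofree.nonempty_generatedMonad {T : ClassCat κ → ClassCat κ}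
    {τ : ∀ X, H.obj (T X) ⟶ T X} {η : ∀ X, X ⟶ T X} (h : ∀ X, IsCofree H (τ X) (η X)) :
    Nonempty (GeneratedMonad H) := by
  have hi : ∀ X, IsIso (desc (τ X) (η X)) := fun X => (h X).isIso_desc
  -- `ext` is Kleisli extension; `hη`, `hid` and `hcomp` are the Kleisli triple laws.
  choose ext hext using fun (X Y : ClassCat κ) (f : X ⟶ T Y) =>
    ((h Y).existsUnique_extension (τ' := τ X) (η' := η X) f).exists
  have hτ : ∀ {X Y : ClassCat κ} (f : X ⟶ T Y), τ X ≫ ext X Y f = H.map (ext X Y f) ≫ τ Y :=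
    fun f => (hext _ _ f).1
  have hη : ∀ {X Y : ClassCat κ} (f : X ⟶ T Y), η X ≫ ext X Y f = f := fun f => (hext _ _ f).2
  have hid : ∀ X, ext X X (η X) = 𝟙 (T X) := fun X =>
    (h X).hom_ext (hτ _) (by rw [H.map_id, Category.id_comp, Category.comp_id])
      (by rw [hη, Category.comp_id])
  have hcomp : ∀ {X Y Z : ClassCat κ} (f : X ⟶ T Y) (g : Y ⟶ T Z),
      ext X Y f ≫ ext Y Z g = ext X Z (f ≫ ext Y Z g) := fun {X Y Z} f g =>
    (h Z).hom_ext (τ' := τ X) (η' := η X)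
      (by rw [← Category.assoc, hτ, Category.assoc, hτ, H.map_comp, Category.assoc]) (hτ _)
      (by rw [← Category.assoc, hη, hη])
  let F : ClassCat κ ⥤ ClassCat κ :=
    { obj := T
      map := fun {X Y} f => ext X Y (f ≫ η Y)
      map_id := fun X => by rw [Category.id_comp, hid]
      map_comp := fun f g => by rw [hcomp, Category.assoc, Category.assoc, hη] }
  let M : Monad (ClassCat κ) :=
    { toFunctor := F
      η := { app := η, naturality := fun X Y f => (hη (f ≫ η Y)).symm }
      μ := { app := fun X => ext (T X) X (𝟙 _)
             naturality := fun X Y f => by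
               change ext _ _ (ext _ _ (f ≫ η Y) ≫ η _) ≫ ext _ _ _ =
                 ext _ _ _ ≫ ext _ _ (f ≫ η Y)
               rw [hcomp, hcomp, Category.assoc, hη, Category.comp_id, Category.id_comp] }
      assoc := fun X => by
        change ext _ _ (ext _ _ (𝟙 _) ≫ η _) ≫ ext _ _ (𝟙 _) = ext _ _ (𝟙 _) ≫ ext _ _ (𝟙 _)
        rw [hcomp, hcomp, Category.assoc, hη, Category.comp_id, Category.id_comp]
      left_unit := fun X => hη _
      right_unit := fun X => by
        change ext _ _ (η X ≫ η _) ≫ ext _ _ (𝟙 _) = _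
        rw [hcomp, Category.assoc, hη, Category.comp_id, hid]
        rfl }
  exact ⟨{ monad := M
           τ := { app := τ, naturality := fun X Y f => (hτ (f ≫ η Y)).symm }
           isIso_desc := hi
           τ_mult := fun X => (hτ (𝟙 (T X))).symm
           terminal := fun X => (h X).nonempty_isTerminal (hi X) }⟩

instance nonempty_generatedMonad (H : ClassCat κ ⥤ ClassCat κ) : Nonempty (GeneratedMonad H) := by
  choose T τ η h using IsCofree.exists_isCofree H
  exact IsCofree.nonempty_generatedMonad h

namespace GeneratedMonad

theorem isCofree (T : GeneratedMonad H) (X : ClassCat κ) :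
    IsCofree H (T.τ.app X) (T.monad.η.app X) :=
  IsCofree.of_isTerminal (T.isIso_desc X) (T.terminal X).some

/-! ### Complete iterativity -/

/-- Guardedness allows a root variable from `X` to be replaced by an element of `HT(X + Y) + Y`.
This makes all of `T(X + Y)` a coalgebra of `H(-) + Y`. Its unique map `k` to `TY` is the
homomorphism `b s` extending `[s, η]` for the unique solution `s`. -/
theorem completelyIterative (T : GeneratedMonad H) : T.toIdealMonad.CompletelyIterative := by
  rintro X Y e ⟨g, he⟩
  let g' : X ⟶ sum (H.obj (T.monad.obj (sum X Y))) Y := g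
  let τ : H.obj (T.monad.obj (sum X Y)) ⟶ T.monad.obj (sum X Y) := T.τ.app (sum X Y)
  let η : sum X Y ⟶ T.monad.obj (sum X Y) := T.monad.η.app (sum X Y)
  let τY : H.obj (T.monad.obj Y) ⟶ T.monad.obj Y := T.τ.app Y
  let ηY : Y ⟶ T.monad.obj Y := T.monad.η.app Y
  have hi : IsIso (desc τ η) := T.isIso_desc (sum X Y)
  let e' : X ⟶ T.monad.obj (sum X Y) := e
  have he' : e' = g' ≫ desc τ (inr X Y ≫ η) := he
  -- the extension of `[s, η]` to an algebra homomorphism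
  let b : (X ⟶ T.monad.obj Y) → (T.monad.obj (sum X Y) ⟶ T.monad.obj Y) := fun s =>
    T.monad.map (desc s ηY) ≫ T.monad.μ.app Y
  have hbτ : ∀ s, τ ≫ b s = H.map (b s) ≫ τY := fun s => by
    have h1 : H.map (T.monad.map (desc s ηY)) ≫ T.τ.app (T.monad.obj Y) =
      τ ≫ T.monad.map (desc s ηY) := T.τ.naturality _
    have h2 : H.map (T.monad.μ.app Y) ≫ τY = T.τ.app (T.monad.obj Y) ≫ T.monad.μ.app Y :=
      T.τ_mult Y
    simp only [b]
    rw [← Category.assoc, ← h1, Category.assoc, ← h2, H.map_comp, Category.assoc]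
  have hbη : ∀ s, η ≫ b s = desc s ηY := fun s => by
    have h1 := T.monad.unit_naturality _ (desc s ηY)
    have h2 := T.monad.left_unit Y
    simp only [b, η]
    rw [← Category.assoc, ← h1, Category.assoc, h2]
    exact Category.comp_id _
  suffices hs : ∃! s : X ⟶ T.monad.obj Y, s = e' ≫ b s from hs
  have hsol : ∀ s, e' ≫ b s = g' ≫ desc (H.map (b s) ≫ τY) ηY := fun s => by
    rw [he', Category.assoc, desc_comp, hbτ, Category.assoc, hbη, inr_desc]
  simp only [hsol]
  let c : sum (H.obj (T.monad.obj (sum X Y))) (sum X Y) ⟶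
      sum (H.obj (T.monad.obj (sum X Y))) Y := desc (inl _ _) (desc g' (inr _ _))
  have hc : ∀ {Z : ClassCat κ} (p : H.obj (T.monad.obj (sum X Y)) ⟶ Z) (q : Y ⟶ Z),
      c ≫ desc p q = desc p (desc (g' ≫ desc p q) q) := fun p q => by
    simp only [c, desc_comp, inl_desc, inr_desc]
  have key : ∀ k : T.monad.obj (sum X Y) ⟶ T.monad.obj Y,
      k = (inv (desc τ η) ≫ c) ≫ desc (H.map k ≫ τY) ηY ↔
        τ ≫ k = H.map k ≫ τY ∧ η ≫ k = desc (g' ≫ desc (H.map k ≫ τY) ηY) ηY := fun k => by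
    rw [Category.assoc, IsIso.eq_inv_comp, desc_comp, hc]
    exact ⟨fun h => ⟨congrArg (inl _ _ ≫ ·) h, congrArg (inr _ _ ≫ ·) h⟩,
      fun h => by rw [h.1, ← h.2]⟩
  obtain ⟨k, hk, hu⟩ := (T.isCofree Y).corec _ (inv (desc τ η) ≫ c)
  have hk' := (key k).1 hk
  have hkb : b (g' ≫ desc (H.map k ≫ τY) ηY) = k :=
    (T.isCofree Y).hom_ext (hbτ _) hk'.1 ((hbη _).trans hk'.2.symm)
  refine ⟨g' ≫ desc (H.map k ≫ τY) ηY, congrArg (fun m => g' ≫ desc (H.map m ≫ τY) ηY) hkb.symm,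
    fun s hs => ?_⟩
  have hb : b s = k := hu _ ((key _).2 ⟨hbτ s, by rw [← hs, hbη]⟩)
  rw [← hb]
  exact hs

end GeneratedMonad

end Generated

/-! ## Freeness -/

section MonadAlgebra

variable {C : Type*} [Category* C] {H : C ⥤ C} {M : CategoryTheory.Monad C}

/-- A natural transformation `l : H ⟶ M` into a monad turns `M X` into an `H`-algebra. -/
def monadAlgebra (l : H ⟶ M.toFunctor) (X : C) : H.obj (M.obj X) ⟶ M.obj X :=
  l.app (M.obj X) ≫ M.μ.app X

variable (l : H ⟶ M.toFunctor)

theorem monadAlgebra_naturality {X Y : C} (f : X ⟶ Y) :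
    H.map (M.map f) ≫ monadAlgebra l Y = monadAlgebra l X ≫ M.map f := by
  have h1 : H.map (M.map f) ≫ l.app (M.obj Y) = l.app (M.obj X) ≫ M.map (M.map f) :=
    l.naturality _
  rw [monadAlgebra, monadAlgebra, ← Category.assoc, h1, Category.assoc, M.mu_naturality,
    Category.assoc]

theorem monadAlgebra_mu (X : C) :
    H.map (M.μ.app X) ≫ monadAlgebra l X = monadAlgebra l (M.obj X) ≫ M.μ.app X := by
  have h1 : H.map (M.μ.app X) ≫ l.app (M.obj X) = l.app (M.obj (M.obj X)) ≫ M.map (M.μ.app X) :=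
    l.naturality _
  rw [monadAlgebra, monadAlgebra, ← Category.assoc, h1, Category.assoc, M.assoc, Category.assoc]

theorem map_unit_monadAlgebra (X : C) : H.map (M.η.app X) ≫ monadAlgebra l X = l.app X := by
  have h1 : H.map (M.η.app X) ≫ l.app (M.obj X) = l.app X ≫ M.map (M.η.app X) := l.naturality _
  rw [monadAlgebra, ← Category.assoc, h1, Category.assoc, M.right_unit]
  exact Category.comp_id _

/-- A monad morphism is a homomorphism of the induced algebras. -/
theorem monadAlgebra_app {N : CategoryTheory.Monad C} (h : MonadHom M N) {l' : H ⟶ N.toFunctor}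
    (hl : l ≫ h.toNatTrans = l') (X : C) :
    monadAlgebra l X ≫ h.app X = H.map (h.app X) ≫ monadAlgebra l' X := by
  have h1 : H.map (h.app X) ≫ l.app (N.obj X) = l.app (M.obj X) ≫ M.map (h.app X) := l.naturality _
  have h2 : l'.app (N.obj X) = l.app (N.obj X) ≫ h.app (N.obj X) := by rw [← hl]; rfl
  rw [monadAlgebra, monadAlgebra, Category.assoc, h.app_μ, h2, Category.assoc, Category.assoc,
    ← Category.assoc (H.map _), h1]
  simp only [Category.assoc]

end MonadAlgebra

section Free

variable {κ : Cardinal.{u}} [Fact κ.IsInaccessible] {H : ClassCat κ ⥤ ClassCat κ}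

/-- In a completely iterative monad `S`, a morphism `f : Y ⟶ S Z` extends uniquely to an algebra
homomorphism from every algebra of the form `A = H A + Y`. -/
theorem IdealMonad.CompletelyIterative.existsUnique_extension {S : IdealMonad κ}
    (hS : S.CompletelyIterative) (l' : H ⟶ S.ideal) {A Y Z : ClassCat κ} (τ : H.obj A ⟶ A)
    (η : Y ⟶ A) [IsIso (desc τ η)] (f : Y ⟶ S.monad.obj Z) :
    ∃! k : A ⟶ S.monad.obj Z, τ ≫ k = H.map k ≫ monadAlgebra (l' ≫ S.incl) Z ∧ η ≫ k = f := by
  have := S.isIso_desc Z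
  let l : H ⟶ S.monad.toFunctor := l' ≫ S.incl
  let ηZ : Z ⟶ S.monad.obj Z := S.monad.η.app Z
  let j : Z ⟶ S.monad.obj (sum A Z) := inr A Z ≫ S.monad.η.app (sum A Z)
  let d : S.monad.obj Z ⟶ sum (S.ideal.obj Z) Z := inv (desc (S.incl.app Z) ηZ)
  have hd : d ≫ desc (S.incl.app Z) ηZ = 𝟙 _ := IsIso.inv_hom_id _
  -- The unknowns are the elements of `A`, the parameters those of `Z`. Guardedness holds on `H A`
  -- because `l` factors through the ideal, and on `Y` because `f` contributes either ideal elements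
  -- or parameters, never bare unknowns.
  let e : A ⟶ S.monad.obj (sum A Z) :=
    inv (desc τ η) ≫ desc (l.app A ≫ S.monad.map (inl A Z)) (f ≫ S.monad.map (inr A Z))
  have hg : S.Guarded e := by
    refine ⟨inv (desc τ η) ≫ desc (l'.app A ≫ S.ideal.map (inl A Z) ≫ inl _ _)
      (f ≫ d ≫ sumMap (S.ideal.map (inr A Z)) (𝟙 Z)), ?_⟩
    change _ = _ ≫ desc (S.incl.app (sum A Z)) j
    have h1 : l.app A ≫ S.monad.map (inl A Z) =
        l'.app A ≫ S.ideal.map (inl A Z) ≫ S.incl.app (sum A Z) := by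
      rw [S.incl.naturality, ← Category.assoc]
      rfl
    have h2 : S.monad.map (inr A Z) =
        d ≫ desc (S.ideal.map (inr A Z) ≫ S.incl.app (sum A Z)) j := by
      have h3 : j = ηZ ≫ S.monad.map (inr A Z) := S.monad.unit_naturality _ _
      rw [S.incl.naturality, h3, ← desc_comp, ← Category.assoc, hd, Category.id_comp]
    simp only [e]
    rw [Category.assoc, desc_comp, h1, h2]
    simp only [Category.assoc, inl_desc, sumMap_desc, Category.id_comp]
  have hsol : ∀ k : A ⟶ S.monad.obj Z, (τ ≫ k = H.map k ≫ monadAlgebra l Z ∧ η ≫ k = f) ↔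
      k = e ≫ S.monad.map (desc k ηZ) ≫ S.monad.μ.app Z := fun k => by
    have h1 : (l.app A ≫ S.monad.map (inl A Z)) ≫ S.monad.map (desc k ηZ) ≫ S.monad.μ.app Z =
        H.map k ≫ monadAlgebra l Z := by
      have h3 : H.map k ≫ l.app (S.monad.obj Z) = l.app A ≫ S.monad.map k := l.naturality k
      rw [monadAlgebra, ← Category.assoc (H.map k), h3, Category.assoc, Category.assoc,
        ← Category.assoc (S.monad.map _), ← S.monad.map_comp, inl_desc]
    have h2 : (f ≫ S.monad.map (inr A Z)) ≫ S.monad.map (desc k ηZ) ≫ S.monad.μ.app Z = f := by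
      rw [Category.assoc, ← Category.assoc (S.monad.map _), ← S.monad.map_comp, inr_desc]
      simp only [ηZ]
      rw [S.monad.right_unit]
      exact Category.comp_id _
    simp only [e]
    rw [Category.assoc, desc_comp, h1, h2, IsIso.eq_inv_comp, desc_comp]
    exact ⟨fun h => by rw [h.1, h.2], fun h => ⟨congrArg (inl _ _ ≫ ·) h, congrArg (inr _ _ ≫ ·) h⟩⟩
  change ∃! k : A ⟶ S.monad.obj Z, τ ≫ k = H.map k ≫ monadAlgebra l Z ∧ η ≫ k = f
  simp only [hsol]
  exact hS A Z e hg

namespace GeneratedMonad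

/-- The algebra structure induced by the universal arrow of a generated monad is `τ`. -/
theorem monadAlgebra_unit (T : GeneratedMonad H) (X : ClassCat κ) :
    monadAlgebra T.unit X = T.τ.app X := by
  have h1 : H.map (T.monad.μ.app X) ≫ T.τ.app X =
    T.τ.app (T.monad.obj X) ≫ T.monad.μ.app X := T.τ_mult X
  change (H.map (T.monad.η.app (T.monad.obj X)) ≫ T.τ.app (T.monad.obj X)) ≫ T.monad.μ.app X = _
  rw [Category.assoc, ← h1, ← Category.assoc, ← H.map_comp, T.monad.left_unit, H.map_id,
    Category.id_comp]

/-- Each component is the homomorphic extension of the unit of `S`. Naturality and compatibility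
with `μ` follow by comparing homomorphisms on variables. A monad morphism respecting the universal
arrows is automatically a homomorphism, so it is unique even without idealness. -/
theorem existsUnique_monadHom (T : GeneratedMonad H) {S : IdealMonad κ}
    (hS : S.CompletelyIterative) (l' : H ⟶ S.ideal) :
    ∃! h : MonadHom T.monad S.monad,
      IdealMonad.IsIdealMorphism T.toIdealMonad S h ∧ T.unit ≫ h.toNatTrans = l' ≫ S.incl := by
  let l : H ⟶ S.monad.toFunctor := l' ≫ S.incl
  have hi := T.isIso_desc
  have ext_hom : ∀ {Y Z : ClassCat κ} {k k' : T.monad.obj Y ⟶ S.monad.obj Z},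
      T.τ.app Y ≫ k = H.map k ≫ monadAlgebra l Z → T.τ.app Y ≫ k' = H.map k' ≫ monadAlgebra l Z →
      T.monad.η.app Y ≫ k = T.monad.η.app Y ≫ k' → k = k' := fun {Y Z k k'} h1 h2 h3 =>
    (hS.existsUnique_extension l' (T.τ.app Y) (T.monad.η.app Y) (T.monad.η.app Y ≫ k')).unique
      ⟨h1, h3⟩ ⟨h2, rfl⟩
  choose h hh using fun Y =>
    (hS.existsUnique_extension l' (T.τ.app Y) (T.monad.η.app Y) (S.monad.η.app Y)).exists
  have hτ : ∀ Y, T.τ.app Y ≫ h Y = H.map (h Y) ≫ monadAlgebra l Y := fun Y => (hh Y).1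
  have hη : ∀ Y, T.monad.η.app Y ≫ h Y = S.monad.η.app Y := fun Y => (hh Y).2
  have comp_hom : ∀ {A X Y : ClassCat κ} (a : H.obj A ⟶ A) (k : A ⟶ S.monad.obj X)
      (g : S.monad.obj X ⟶ S.monad.obj Y), a ≫ k = H.map k ≫ monadAlgebra l X →
      H.map g ≫ monadAlgebra l Y = monadAlgebra l X ≫ g →
      a ≫ k ≫ g = H.map (k ≫ g) ≫ monadAlgebra l Y := fun a k g h1 h2 => by
    rw [← Category.assoc, h1, Category.assoc, ← h2, H.map_comp, Category.assoc]
  have comp_hom' : ∀ {X Y : ClassCat κ} {A : ClassCat κ} (a : H.obj A ⟶ A)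
      (k : A ⟶ T.monad.obj X) (g : T.monad.obj X ⟶ S.monad.obj Y),
      a ≫ k = H.map k ≫ T.τ.app X → T.τ.app X ≫ g = H.map g ≫ monadAlgebra l Y →
      a ≫ k ≫ g = H.map (k ≫ g) ≫ monadAlgebra l Y := fun a k g h1 h2 => by
    rw [← Category.assoc, h1, Category.assoc, h2, H.map_comp, Category.assoc]
  have hnat : ∀ {X Y : ClassCat κ} (f : X ⟶ Y), T.monad.map f ≫ h Y = h X ≫ S.monad.map f :=
    fun {X Y} f => by
      refine ext_hom (comp_hom' _ _ _ (T.τ.naturality f).symm (hτ Y))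
        (comp_hom _ _ _ (hτ X) (monadAlgebra_naturality l f)) ?_
      rw [← Category.assoc, ← T.monad.unit_naturality, Category.assoc, hη, ← Category.assoc, hη]
      exact S.monad.unit_naturality _ f
  let hT : MonadHom T.monad S.monad :=
    { app := h
      naturality := fun _ _ f => hnat f
      app_η := hη
      app_μ := fun X => by
        refine ext_hom (comp_hom' _ _ _ (T.τ_mult X).symm (hτ X)) ?_ ?_
        · rw [hnat, Category.assoc]
          exact comp_hom _ _ _ (hτ _) (comp_hom _ _ _ (monadAlgebra_naturality l _).symm
            (monadAlgebra_mu l X)).symm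
        · rw [← Category.assoc, T.monad.left_unit, Category.id_comp, hnat, ← Category.assoc,
            ← Category.assoc, hη, ← S.monad.unit_naturality, Category.assoc, S.monad.left_unit]
          exact (Category.comp_id _).symm }
  refine ⟨hT, ⟨⟨?_, ?_⟩, ?_⟩, ?_⟩
  -- The restriction to ideals is the composite `HT ⟶ HS ⟶ S'S ⟶ S'`.
  · exact Functor.whiskerRight hT.toNatTrans H ≫ Functor.whiskerLeft S.monad.toFunctor l' ≫ S.mult
  · ext X : 2
    change T.τ.app X ≫ h X = (H.map (h X) ≫ l'.app _ ≫ S.mult.app X) ≫ S.incl.app X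
    rw [hτ, Category.assoc, Category.assoc, S.mult_incl, ← Category.assoc (l'.app _)]
    rfl
  · ext X : 2
    change (H.map (T.monad.η.app X) ≫ T.τ.app X) ≫ h X = l.app X
    rw [Category.assoc, hτ, ← Category.assoc, ← H.map_comp, hη, map_unit_monadAlgebra]
  · rintro g ⟨-, hg⟩
    refine MonadHom.ext (funext fun X => ?_)
    refine ext_hom ?_ (hτ X) ((g.app_η X).trans (hη X).symm)
    rw [← T.monadAlgebra_unit]
    exact monadAlgebra_app T.unit g hg X

/-- The generated monad is a free completely iterative monad. -/
theorem isFreeOn (T : GeneratedMonad H) : IdealMonad.IsFreeOn H T.toIdealMonad T.unit := by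
  refine ⟨T.completelyIterative, ⟨Functor.whiskerRight T.monad.η H, rfl⟩, ?_⟩
  rintro S _ hS ⟨l', rfl⟩
  exact T.existsUnique_monadHom hS l'

end GeneratedMonad

end Free

/-! ## Free completely iterative monads as quotients of tree monads -/

section TreeQuotient

variable {κ : Cardinal.{u}} [Fact κ.IsInaccessible] {H : ClassCat κ ⥤ ClassCat κ}

open Signature

namespace GeneratedMonad

variable {Sg : Signature κ} (T : GeneratedMonad H) (ε : Sg.poly ⟶ H)

/-- The interpretation in `T Y` of the operation symbols of `Σ`. -/
def op (Y : ClassCat κ) (s : Sg.Op.carrier) (g : Sg.Pos s → (T.monad.obj Y).carrier) :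
    (T.monad.obj Y).carrier :=
  T.τ.app Y (ε.app (T.monad.obj Y) ⟨s, g⟩)

theorem hom_op {A Y : ClassCat κ} (r : A ⟶ T.monad.obj Y)
    (s : Sg.Op.carrier) (g : Sg.Pos s → A.carrier) :
    T.τ.app Y (H.map r (ε.app A ⟨s, g⟩)) = T.op ε Y s fun i => r (g i) :=
  congrArg (T.τ.app Y) (congrFun (ε.naturality r) ⟨s, g⟩).symm

theorem map_op {X Y : ClassCat κ} {r : T.monad.obj X ⟶ T.monad.obj Y}
    (hr : H.map r ≫ T.τ.app Y = T.τ.app X ≫ r) (s : Sg.Op.carrier)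
    (g : Sg.Pos s → (T.monad.obj X).carrier) :
    r (T.op ε X s g) = T.op ε Y s fun i => r (g i) :=
  (congrFun hr (ε.app _ ⟨s, g⟩)).symm.trans (T.hom_op ε r s g)

theorem eq_corec_iff {X Y : ClassCat κ} (f : X ⟶ T.monad.obj Y)
    (k : Sg.treeObj X ⟶ T.monad.obj Y) :
    k = (Signature.Tree.split Sg X ≫ sumMap (ε.app _) (𝟙 X)) ≫ desc (H.map k ≫ T.τ.app Y) f ↔
      (∀ s g, k (Signature.Tree.node s g) = T.op ε Y s fun i => k (g i)) ∧
        ∀ x, k (Signature.Tree.leaf Sg x) = f x := by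
  refine ⟨fun h => ⟨fun s g => ?_, fun x => congrFun h (Signature.Tree.leaf Sg x)⟩,
    fun h => funext fun t => ?_⟩
  · exact (congrFun h (Signature.Tree.node s g)).trans (T.hom_op ε k s g)
  · rcases Signature.Tree.leaf_or_node t with ⟨x, rfl⟩ | ⟨s, g, rfl⟩
    · exact h.2 x
    · exact (h.1 s g).trans (T.hom_op ε k s g).symm

/-- Every `f : X ⟶ T Y` extends uniquely to a homomorphism on `Σ`-trees over `X`. -/
theorem existsUnique_tree_extension {X Y : ClassCat κ} (f : X ⟶ T.monad.obj Y) :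
    ∃! k : Sg.treeObj X ⟶ T.monad.obj Y,
      (∀ s g, k (Signature.Tree.node s g) = T.op ε Y s fun i => k (g i)) ∧
        ∀ x, k (Signature.Tree.leaf Sg x) = f x := by
  simp only [← eq_corec_iff]
  exact (T.isCofree Y).corecSubst _ f

/-- The evaluation of `Σ`-trees in a generated monad, as a monad morphism. -/
theorem exists_treeMonad_hom (hε : ∀ X, Epi (ε.app X)) :
    ∃ q : MonadHom Sg.treeMonad T.monad,
      (∀ X, Epi (q.app X)) ∧ Sg.flat ≫ q.toNatTrans = ε ≫ T.unit := by
  choose q hq using fun Y => (T.existsUnique_tree_extension ε (X := Y) (T.monad.η.app Y)).exists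
  have hnode : ∀ Y s g, q Y (Signature.Tree.node s g) = T.op ε Y s fun i => q Y (g i) :=
    fun Y => (hq Y).1
  have hleaf : ∀ Y (y : Y.carrier), q Y (Signature.Tree.leaf Sg y) = T.monad.η.app Y y :=
    fun Y => (hq Y).2
  have subst_node : ∀ {X Y : ClassCat κ} (f : X.carrier → Signature.Tree Sg Y) (s : Sg.Op.carrier)
      (g : Sg.Pos s → Signature.Tree Sg X), q Y (Signature.Tree.subst f (Signature.Tree.node s g)) =
        T.op ε Y s fun i => q Y (Signature.Tree.subst f (g i)) := fun f s g => by
    rw [Signature.Tree.subst_node]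
    exact hnode _ _ _
  have hnat : ∀ {X Y : ClassCat κ} (f : X ⟶ Y),
      Sg.treeFunctor.map f ≫ q Y = q X ≫ T.monad.map f := fun {X Y} f =>
    (T.existsUnique_tree_extension ε (f ≫ T.monad.η.app Y)).unique
      ⟨fun s g => subst_node _ s g, fun x => (congrArg (q Y) (Signature.Tree.subst_leaf _ _)).trans
        (hleaf Y (f x))⟩
      ⟨fun s g => (congrArg (T.monad.map f) (hnode X s g)).trans
          (T.map_op ε (T.τ.naturality f) s _),
        fun x => (congrArg (T.monad.map f) (hleaf X x)).trans
          (congrFun (T.monad.η.naturality f) x).symm⟩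
  have hmul : ∀ Y, Sg.treeMonad.μ.app Y ≫ q Y =
      (Sg.treeFunctor.map (q Y) ≫ q (T.monad.obj Y)) ≫ T.monad.μ.app Y := fun Y => by
    refine (T.existsUnique_tree_extension ε (X := Sg.treeObj Y) (q Y)).unique
      ⟨fun s g => subst_node (X := Sg.treeObj Y) _ s g, fun t => congrArg (q Y)
        (Signature.Tree.subst_leaf (Y := Sg.treeObj Y) _ _)⟩ ⟨fun s g => ?_, fun t => ?_⟩
    · exact (congrArg (T.monad.μ.app Y) (subst_node (X := Sg.treeObj Y) _ s g)).trans
        (T.map_op ε (X := T.monad.obj Y) (T.τ_mult Y) s _)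
    · have h1 : q (T.monad.obj Y) (Sg.treeFunctor.map (q Y)
          (Signature.Tree.leaf Sg (Y := Sg.treeObj Y) t)) =
          T.monad.η.app (T.monad.obj Y) (q Y t) :=
        (congrArg (q (T.monad.obj Y)) (Signature.Tree.subst_leaf (Y := Sg.treeObj Y) _ _)).trans
          (hleaf _ _)
      exact (congrArg (T.monad.μ.app Y) h1).trans (congrFun (T.monad.left_unit Y) (q Y t))
  refine ⟨{ app := q, naturality := fun _ _ f => hnat f,
            app_η := fun Y => funext (hleaf Y), app_μ := hmul }, fun Y => ?_, ?_⟩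
  · have hi := T.isIso_desc Y
    let a : T.monad.obj Y ⟶ sum (H.obj (T.monad.obj Y)) Y :=
      inv (desc (T.τ.app Y) (T.monad.η.app Y))
    obtain ⟨m⟩ := treeCoalgebra_weaklyTerminal ε hε Y ⟨T.monad.obj Y, a⟩
    let m' : T.monad.obj Y ⟶ Sg.treeObj Y := m.f
    have hm : a ≫ sumMap (H.map m') (𝟙 Y) =
        m' ≫ Signature.Tree.split Sg Y ≫ sumMap (ε.app _) (𝟙 Y) := m.h
    have h1 := (T.eq_corec_iff (X := Y) ε (T.monad.η.app Y) (q Y)).2 (hq Y)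
    -- Both sides solve the corecursion equation of the canonical coalgebra on `T Y`, so `m'` is a
    -- section of `q Y`.
    have h2 : m' ≫ q Y = 𝟙 _ := by
      refine (T.isCofree Y).corec_unique a ?_ ?_
      · have h3 := congrArg (m' ≫ ·) h1
        rw [← Category.assoc m', ← hm, Category.assoc, sumMap_desc, Category.id_comp,
          ← Category.assoc, ← H.map_comp] at h3
        exact h3
      · rw [H.map_id, Category.id_comp]
        exact (IsIso.inv_hom_id (desc (T.τ.app Y) (T.monad.η.app Y))).symm
    exact epi_of_surjective fun y => ⟨m' y, congrFun h2 y⟩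
  · ext Y : 2
    funext ⟨s, g⟩
    refine (hnode Y s _).trans ?_
    have h1 := T.hom_op ε (T.monad.η.app Y) s g
    refine Eq.trans ?_ h1.symm
    exact congrArg (T.op ε Y s) (funext fun i => hleaf Y (g i))

end GeneratedMonad

/-! ### Comparison of free completely iterative monads -/

namespace IdealMonad

theorem IsIdealMorphism.comp {S R Q : IdealMonad κ} {h : MonadHom S.monad R.monad}
    {k : MonadHom R.monad Q.monad} (hh : IsIdealMorphism S R h) (hk : IsIdealMorphism R Q k) :
    IsIdealMorphism S Q (CategoryStruct.comp (obj := CategoryTheory.Monad (ClassCat κ)) h k) := by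
  obtain ⟨h', hh⟩ := hh
  obtain ⟨k', hk⟩ := hk
  refine ⟨h' ≫ k', ?_⟩
  rw [Category.assoc, ← hk, ← Category.assoc, ← hh, Category.assoc]
  rfl

theorem IsIdealMorphism.id (S : IdealMonad κ) : IsIdealMorphism S S (𝟙 S.monad) := ⟨𝟙 _, rfl⟩

/-- Between free completely iterative monads on `H` there is a monad morphism with epimorphic
components which respects the universal arrows. -/
theorem IsFreeOn.exists_epi {T T' : IdealMonad κ} {i : H ⟶ T.monad.toFunctor}
    {i' : H ⟶ T'.monad.toFunctor} (hT : IsFreeOn H T i) (hT' : IsFreeOn H T' i') :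
    ∃ h : T.monad ⟶ T'.monad, (∀ X, Epi (h.app X)) ∧ i ≫ h.toNatTrans = i' := by
  obtain ⟨h, ⟨hh, hi⟩, -⟩ := hT.2.2 T' i' hT'.1 hT'.2.1
  obtain ⟨k, ⟨hk, ki⟩, -⟩ := hT'.2.2 T i hT.1 hT.2.1
  let h' : T.monad ⟶ T'.monad := h
  let k' : T'.monad ⟶ T.monad := k
  -- One composite suffices, as it already splits the components of `h'`.
  have hkh : k' ≫ h' = 𝟙 T'.monad := by
    refine (hT'.2.2 T' i' hT'.1 hT'.2.1).unique ⟨hk.comp hh, ?_⟩ ⟨IsIdealMorphism.id T', rfl⟩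
    change i' ≫ k.toNatTrans ≫ h.toNatTrans = i'
    rw [← Category.assoc, ki, hi]
  refine ⟨h', fun X => ?_, hi⟩
  have h1 : k'.app X ≫ h'.app X = 𝟙 _ := congrArg (fun m : T'.monad ⟶ T'.monad => m.app X) hkh
  exact epi_of_surjective fun y => ⟨k'.app X y, congrFun h1 y⟩

end IdealMonad

end TreeQuotient

theorem mainTheorem7 (κ : Cardinal.{u}) [Fact κ.IsInaccessible]
    (H : ClassCat κ ⥤ ClassCat κ) :
    (∀ X : ClassCat κ, HasTerminal (Endofunctor.Coalgebra (ClassCat.plus H X))) ∧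
    (∃ T : GeneratedMonad H, IdealMonad.IsFreeOn H T.toIdealMonad T.unit) ∧
    (∃ (Sg : Signature κ) (ε : Sg.poly ⟶ H), ∀ X, Epi (ε.app X)) ∧
    (∀ (T : IdealMonad κ) (i : H ⟶ T.monad.toFunctor), IdealMonad.IsFreeOn H T i →
      ∀ (Sg : Signature κ) (ε : Sg.poly ⟶ H), (∀ X, Epi (ε.app X)) →
        ∃ q : MonadHom Sg.treeMonad T.monad,
          (∀ X, Epi (q.app X)) ∧ Sg.flat ≫ q.toNatTrans = ε ≫ i) := by
  obtain ⟨T₀⟩ := nonempty_generatedMonad H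
  refine ⟨Signature.hasTerminal_coalgebra_plus H, ⟨T₀, T₀.isFreeOn⟩,
    ⟨Signature.ofFunctor H, Signature.presentation H, Signature.epi_presentation_app H⟩, ?_⟩
  intro T i hT Sg ε hε
  -- An arbitrary free `T` has no given decomposition `HT + Id`, so trees are evaluated in `T₀` and
  -- the result is transported along the comparison morphism.
  obtain ⟨q, hq, hqi⟩ := T₀.exists_treeMonad_hom ε hε
  obtain ⟨h, hh, hi⟩ := T₀.isFreeOn.exists_epi hT
  let q' : Sg.treeMonad ⟶ T₀.monad := q
  let h' : T₀.monad ⟶ T.monad := h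
  refine ⟨q' ≫ h', fun X => ?_, ?_⟩
  · have h1 : Epi (q'.app X) := hq X
    have h2 : Epi (h'.app X) := hh X
    exact epi_comp (q'.app X) (h'.app X)
  · let n : T₀.monad.toFunctor ⟶ T.monad.toFunctor := h'.toNatTrans
    have hn : T₀.unit ≫ n = i := hi
    change Sg.flat ≫ q.toNatTrans ≫ n = ε ≫ i
    rw [← hn, ← Category.assoc, hqi, Category.assoc]
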